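/- **Setting.** A network $\mathcal N$ consists of a finite directed acyclic multigraph with node set $\nu$ and edge set $\epsilon$, a finite message set $\mu$, positive integer edge capacities $c(e)$, a finite alphabet with at least two elements, and maps $S,R:\nu\to 2^{\mu}$ giving the messages generated, respectively demanded, at each node. The network is assumed nondegenerate (whenever $x$ demands $m$ there is a directed path to $x$ from a node generating $m$, and no node both generates and demands the same message), and every message is demanded by at least one node. Let $F$ be a finite field whose cardinality is at least that of the alphabet. A $(\hat k,n)$ fractional code over $F$ (with all $k_m\ge 1$ and $n\ge 1$) gives each message $m$ a vector in $F^{k_m}$ and each edge $e$ a vector in $F^{n\,c(e)}$. The vector on an edge is a function of the messages generated at the start node of the edge and of the vectors on the in-edges of that node, and each demand is decoded by a function of the corresponding data at the receiver. The code is a solution if all demands are decoded correctly for every message assignment, and it is linear if all these functions are $F$-linear. Let $\mathcal C_l$ be the closure in $\mathbb R^{\mu}$ of the rate vectors $(k_m/n)_{m\in\mu}$ of linear solutions over arbitrary finite fields with at least as many elements as the alphabet, and let $\mathcal C_l(F)$ be the closure of the rate vectors of those over $F$. A partial scalar-linear solution $W$ is a nonempty set $T_W\subseteq\mu$ together with a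 linear solution over $F$, with all source dimensions and the edge dimension equal to $1$, of the network with unit capacities in which only the messages of $T_W$ are considered. Put $W(e)=1$ if the symbol carried by $e$ under $W$ is not identically zero, and $W(e)=0$ otherwise. Let $\mathcal W$ be the (finite) set of all partial scalar-linear solutions. A linear solution is simple if it decomposes into a finite family (repetitions allowed) of partial scalar-linear solutions: every coordinate of a message $m$ is assigned to exactly one member $W$ with $m\in T_W$, each such member receiving exactly one coordinate of $m$; every member with $W(e)=1$ has its own coordinate of $e$; on these coordinates the code acts as the members do, separately; and all other edge coordinates are zero. Let $\mathcal C'_l$ be the closure of the rate vectors of simple linear solutions over $F$. **Theorem.** Fix a finite field $F$. 1. For every network as above, $\mathcal C'_l$ is a bounded rational polytope (the convex hull of finitely many points with rational coordinates) contained in $\mathbb R_{\ge 0}^{\mu}$. The set $$\mathcal P=\Bigl\{x\in\mathbb R^{\mathcal W} : x\ge 0,\ \sum_{W\in\mathcal W}W(e)\,x(W)\le c(e)\ \text{ for all } e\in\epsilon\Bigr\}$$ is a rational polytope, and $\mathcal C'_l$ is its image under the linear map $x\mapsto\bigl(\sum_{W:\,m\in T_W}x(W)\bigr)_{m\in\mu}$.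 Moreover $\mathcal C'_l\subseteq\mathcal C_l(F)$ and $\mathcal C'_l\subseteq\mathcal C_l$. 2. $\mathcal C'_l$ is computable: there is a computable function which, for every network as above whose nodes, edges, messages and alphabet symbols are numbered, takes the finite description of the network (numbers of nodes and messages, alphabet size, list of edges with end points and capacities, tables of $S$ and $R$) to a finite list of rational points that are exactly the extreme points of $\mathcal C'_l$, and $\mathcal C'_l$ is the convex hull of these points. -/

import Mathlib

/-- A capacitated network: a finite directed acyclic multigraph with node set `V`, edge set `E`,
message set `M`, alphabet `A`, positive integer edge capacities, a source mapping `S` and a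
receiver mapping `R`.  (Finiteness of `V`, `E`, `M` is an instance argument where needed.) -/
structure CapNetwork (V E M A : Type*) where
  /-- start node of an edge -/
  src : E → V
  /-- end node of an edge -/
  tgt : E → V
  /-- edge capacity -/
  cap : E → ℕ
  /-- messages generated by a node -/
  S : V → Set M
  /-- messages demanded by a node -/
  R : V → Set M
  cap_pos : ∀ e, 0 < cap e
  /-- the alphabet is a finite set with at least two elements -/
  two_le_card : 2 ≤ Nat.card A
  acyclic : ∀ x, ¬ Relation.TransGen (fun y z => ∃ e, src e = y ∧ tgt e = z) x x

namespace CapNetwork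

variable {V E M A : Type*}

/-- `y` and `z` are joined by an edge from `y` to `z`. -/
def Adj (N : CapNetwork V E M A) (y z : V) : Prop := ∃ e, N.src e = y ∧ N.tgt e = z

/-- For each demand of a message at a node there is a directed path to that node from a node
generating the message, and no message is both generated and demanded by the same node. -/
def Nondegenerate (N : CapNetwork V E M A) : Prop :=
  (∀ x, ∀ m ∈ N.R x, ∃ y, m ∈ N.S y ∧ Relation.ReflTransGen N.Adj y x) ∧
  (∀ x m, m ∈ N.S x → m ∉ N.R x)

/-- Every message is demanded by at least one node. -/
def EveryMessageDemanded (N : CapNetwork V E M A) : Prop := ∀ m, ∃ x, m ∈ N.R x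

/-- The inputs available at node `x` under a `(k, n)` fractional code: a vector in `F ^ (k m)` for
each message `m` generated by `x` and a vector in `F ^ (n c(e))` for each in-edge `e` of `x`. -/
abbrev Inputs (N : CapNetwork V E M A) (F : Type*) (k : M → ℕ) (n : ℕ) (x : V) :=
  (∀ m : {m // m ∈ N.S x}, Fin (k m) → F) ×
    (∀ e : {e // N.tgt e = x}, Fin (n * N.cap e) → F)

/-- A fractional network code over `F` with source dimension vector `k` and edge dimension `n`. -/
structure FracCode (N : CapNetwork V E M A) (F : Type*) (k : M → ℕ) (n : ℕ) where
  card_le : Nat.card A ≤ Nat.card F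
  /-- fractional edge functions -/
  edgeFn : ∀ e, N.Inputs F k n (N.src e) → Fin (n * N.cap e) → F
  /-- fractional decoding functions -/
  decFn : ∀ (x : V) (m : {m // m ∈ N.R x}), N.Inputs F k n x → Fin (k m) → F

/-- The relation "`e'` is an in-edge of the start node of `e`" is well founded. -/
theorem edge_wf [Finite E] (N : CapNetwork V E M A) :
    WellFounded (fun e' e : E => N.tgt e' = N.src e) := by
  have key : ∀ e e' : E, Relation.TransGen (fun e' e : E => N.tgt e' = N.src e) e e' →
      Relation.TransGen (fun y z => ∃ e, N.src e = y ∧ N.tgt e = z) (N.src e) (N.src e') := by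
    intro e e' h
    induction h with
    | single h => exact Relation.TransGen.single ⟨e, rfl, h⟩
    | tail _ h ih => exact ih.tail ⟨_, rfl, h⟩
  have hirr : Std.Irrefl (Relation.TransGen (fun e' e : E => N.tgt e' = N.src e)) :=
    ⟨fun e h => N.acyclic _ (key e e h)⟩
  have : WellFounded (Relation.TransGen (fun e' e : E => N.tgt e' = N.src e)) :=
    Finite.wellFounded_of_trans_of_irrefl _
  exact Subrelation.wf (r := Relation.TransGen (fun e' e : E => N.tgt e' = N.src e))
    (fun {_ _} h => Relation.TransGen.single h) this

namespace FracCode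

variable {N : CapNetwork V E M A} {F : Type*} {k : M → ℕ} {n : ℕ}

/-- The symbol function of a code under a message assignment `a`, defined recursively along the
acyclic network. -/
noncomputable def symbol [Finite E] (C : N.FracCode F k n) (a : ∀ m, Fin (k m) → F) :
    ∀ e, Fin (n * N.cap e) → F :=
  N.edge_wf.fix fun e ih => C.edgeFn e (fun m => a m, fun e' => ih e'.1 e'.2)

theorem symbol_eq [Finite E] (C : N.FracCode F k n) (a : ∀ m, Fin (k m) → F) (e : E) :
    C.symbol a e = C.edgeFn e (fun m => a m, fun e' => C.symbol a e'.1) :=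
  WellFounded.fix_eq _ _ _

/-- Every demand is satisfied under every message assignment. -/
def IsSolution [Finite E] (C : N.FracCode F k n) : Prop :=
  ∀ (a : ∀ m, Fin (k m) → F) (x : V) (m : {m // m ∈ N.R x}),
    C.decFn x m (fun m' => a m', fun e => C.symbol a e.1) = a m

/-- All edge functions and decoding functions are linear over `F`. -/
def IsLinear [Field F] (C : N.FracCode F k n) : Prop :=
  (∀ e, IsLinearMap F (C.edgeFn e)) ∧ ∀ x m, IsLinearMap F (C.decFn x m)

/-- The edge `e` is active: it carries a symbol that is not identically zero. -/
def Uses [Finite E] [Zero F] (C : N.FracCode F k n) (e : E) : Prop :=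
  ∃ a, C.symbol a e ≠ 0

end FracCode

/-- The network with unit edge capacities in which only the messages of `T` are considered. -/
def unitRestrict (N : CapNetwork V E M A) (T : Set M) : CapNetwork V E T A where
  src := N.src
  tgt := N.tgt
  cap := fun _ => 1
  S := fun x => {m | (m : M) ∈ N.S x}
  R := fun x => {m | (m : M) ∈ N.R x}
  cap_pos := fun _ => Nat.one_pos
  two_le_card := N.two_le_card
  acyclic := N.acyclic

/-- A partial scalar-linear network code solution: a nonempty set `T` of messages (the support of
a weight vector) together with a linear code solution with all source dimensions and the edge
dimension equal to `1` for the network with unit edge capacities and message set `T`. -/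
structure PartialSolution (N : CapNetwork V E M A) (F : Type*) [Field F] [Finite E] where
  T : Set M
  nonempty : T.Nonempty
  code : (N.unitRestrict T).FracCode F (fun _ => 1) 1
  linear : code.IsLinear
  solution : code.IsSolution

instance finite_fracCode [Finite V] [Finite E] [Finite M] (N : CapNetwork V E M A) (F : Type*)
    [Finite F] (k : M → ℕ) (n : ℕ) : Finite (N.FracCode F k n) := by
  apply Finite.of_injective
    (fun C : N.FracCode F k n => (C.edgeFn, C.decFn))
  rintro ⟨h, a, b⟩ ⟨h', a', b'⟩ hab
  simp only [Prod.mk.injEq] at hab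
  obtain ⟨rfl, rfl⟩ := hab
  rfl

instance finite_partialSolution [Finite V] [Finite E] [Finite M] (N : CapNetwork V E M A)
    (F : Type*) [Field F] [Finite F] : Finite (N.PartialSolution F) := by
  apply Finite.of_injective
    (fun W : N.PartialSolution F =>
      (⟨W.T, W.code⟩ : Σ T : Set M, (N.unitRestrict T).FracCode F (fun _ => 1) 1))
  rintro ⟨T, h1, c, h2, h3⟩ ⟨T', h1', c', h2', h3'⟩ h
  simp only [Sigma.mk.injEq] at h
  obtain ⟨rfl, h⟩ := h
  obtain rfl := eq_of_heq h
  rfl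

noncomputable instance fintype_partialSolution [Finite V] [Finite E] [Finite M]
    (N : CapNetwork V E M A) (F : Type*) [Field F] [Finite F] : Fintype (N.PartialSolution F) :=
  Fintype.ofFinite _

/-- The unique coordinate of an edge of the unit capacity network at edge dimension `1`. -/
def edgeCoord (N : CapNetwork V E M A) (T : Set M) (e : E) :
    Fin (1 * (N.unitRestrict T).cap e) := ⟨0, Nat.one_pos⟩

section Decomposition

variable [Finite E] {N : CapNetwork V E M A} {F : Type*} [Field F] {k : M → ℕ} {n r : ℕ}

open Classical in
/-- Given an allocation of the coordinates of messages (`σ`) and of edges (`τ`) to the members of a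
family `W` of partial scalar-linear solutions, the part of the inputs at the node `x` that belongs
to the member `W t`; an in-edge that `W t` does not use contributes `0`. -/
noncomputable def component (W : Fin r → N.PartialSolution F)
    (σ : ∀ m, Fin (k m) ≃ {t // m ∈ (W t).T})
    (τ : ∀ e, {t // (W t).code.Uses e} ↪ Fin (n * N.cap e))
    (x : V) (u : N.Inputs F k n x) (t : Fin r) :
    (N.unitRestrict (W t).T).Inputs F (fun _ => 1) 1 x :=
  (fun m _ => u.1 ⟨m.1.1, m.2⟩ ((σ m.1.1).symm ⟨t, m.1.2⟩),
   fun e _ => if h : (W t).code.Uses e.1 then u.2 ⟨e.1, e.2⟩ (τ e.1 ⟨t, h⟩) else 0)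

/-- The code `C` decomposes into a finite family `W` of partial scalar-linear solutions
(repetitions allowed): each coordinate of a message `m` belongs to exactly one member
transmitting `m`, every member using an edge `e` has its own coordinate of `e`, and on
these coordinates `C` acts as the members do, separately; the other coordinates of edges are
inactive. -/
def FracCode.IsDecomposable (C : N.FracCode F k n) : Prop :=
  ∃ (r : ℕ) (W : Fin r → N.PartialSolution F)
    (σ : ∀ m, Fin (k m) ≃ {t // m ∈ (W t).T})
    (τ : ∀ e, {t // (W t).code.Uses e} ↪ Fin (n * N.cap e)),
    (∀ e (u : N.Inputs F k n (N.src e)) (t : {t // (W t).code.Uses e}),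
      C.edgeFn e u (τ e t) =
        (W t).code.edgeFn e (component W σ τ (N.src e) u t) (N.edgeCoord (W t).T e)) ∧
    (∀ e (u : N.Inputs F k n (N.src e)), ∀ j ∉ Set.range (τ e), C.edgeFn e u j = 0) ∧
    (∀ x (m : {m // m ∈ N.R x}) (u : N.Inputs F k n x) (i : Fin (k m)),
      C.decFn x m u i =
        (W (σ m i)).code.decFn x ⟨⟨m, (σ m i).2⟩, m.2⟩ (component W σ τ x u (σ m i)) 0)

/-- A simple fractional linear network code solution. -/
def FracCode.IsSimple (C : N.FracCode F k n) : Prop :=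
  C.IsLinear ∧ C.IsSolution ∧ C.IsDecomposable

end Decomposition

section Regions

variable [Finite E] (N : CapNetwork V E M A)

/-- The coding rate vectors achievable by fractional linear network code solutions over `F`. -/
def linearRates (F : Type*) [Field F] : Set (M → ℝ) :=
  {ρ | ∃ (k : M → ℕ) (n : ℕ) (C : N.FracCode F k n), (∀ m, 0 < k m) ∧ 0 < n ∧
    C.IsLinear ∧ C.IsSolution ∧ ρ = fun m => (k m : ℝ) / n}

/-- The network linear coding capacity region with respect to `F`. -/
def linearRegionOver (F : Type*) [Field F] : Set (M → ℝ) := closure (N.linearRates F)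

/-- The network linear coding capacity region, where all finite fields are allowed. -/
def linearRegion : Set (M → ℝ) :=
  closure {ρ | ∃ (F : Type) (_ : Field F) (_ : Finite F), ρ ∈ N.linearRates F}

/-- The coding rate vectors achievable by simple fractional linear network code solutions. -/
def simpleRates (F : Type*) [Field F] : Set (M → ℝ) :=
  {ρ | ∃ (k : M → ℕ) (n : ℕ) (C : N.FracCode F k n), (∀ m, 0 < k m) ∧ 0 < n ∧
    C.IsSimple ∧ ρ = fun m => (k m : ℝ) / n}

/-- The semi-network linear coding capacity region with respect to `F`. -/
def semiRegion (F : Type*) [Field F] : Set (M → ℝ) := closure (N.simpleRates F)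

variable [Finite V] [Finite M] (F : Type*) [Field F] [Finite F]

open Classical in
/-- The packing polytope over partial scalar-linear solutions. -/
def packingPolytope : Set (N.PartialSolution F → ℝ) :=
  {x | (∀ W, 0 ≤ x W) ∧ ∀ e, ∑ W, (if W.code.Uses e then 1 else 0) * x W ≤ N.cap e}

open Classical in
/-- The map sending `x` to the vector whose coordinate at the message `m` is the sum of `x W` over
the partial scalar-linear solutions `W` that transmit `m`. -/
noncomputable def rateMap : (N.PartialSolution F → ℝ) →ₗ[ℝ] (M → ℝ) where
  toFun x := fun m => ∑ W, (if m ∈ W.T then 1 else 0) * x W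
  map_add' x y := by
    funext m
    simp only [Pi.add_apply, mul_add, Finset.sum_add_distrib]
  map_smul' c x := by
    funext m
    simp only [Pi.smul_apply, smul_eq_mul, RingHom.id_apply, Finset.mul_sum]
    exact Finset.sum_congr rfl fun _ _ => by ring

end Regions

/-- Descriptions of networks as finite data: number of nodes, number of messages, alphabet size,
list of edges (start node, end node, capacity), and the tables of the source mapping and of the
receiver mapping (one row for each node, one entry for each message). -/
abbrev Description :=
  ℕ × ℕ × ℕ × List (ℕ × ℕ × ℕ) × List (List Bool) × List (List Bool)

open Classical in
/-- The description of a network with nodes, edges, messages and alphabet numbered from `0`. -/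
noncomputable def description {v e m q : ℕ} (N : CapNetwork (Fin v) (Fin e) (Fin m) (Fin q)) :
    Description :=
  (v, m, q,
    List.ofFn fun i => ((N.src i : ℕ), (N.tgt i : ℕ), N.cap i),
    List.ofFn fun x => List.ofFn fun j => decide (j ∈ N.S x),
    List.ofFn fun x => List.ofFn fun j => decide (j ∈ N.R x))

end CapNetwork

/-- A rational polytope: the convex hull of finitely many points with rational coordinates. -/
def IsRationalPolytope {ι : Type*} (P : Set (ι → ℝ)) : Prop :=
  ∃ s : Set (ι → ℚ), s.Finite ∧ P = convexHull ℝ ((fun q i => (q i : ℝ)) '' s)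

/-- The point of `ℝ ^ m` written as a list of fractions (numerator, denominator). -/
noncomputable def pointOfFractions (m : ℕ) (p : List (ℕ × ℕ)) : Fin m → ℝ :=
  fun i => ((p.getD i (0, 1)).1 : ℝ) / ((p.getD i (0, 1)).2 : ℝ)

/-- The list `l` of lists of fractions is the vertex description of `P`: the points it lists are
exactly the extreme points of `P`, and `P` is their convex hull. -/
def IsVertexDescription {m : ℕ} (l : List (List (ℕ × ℕ))) (P : Set (Fin m → ℝ)) : Prop :=
  (∀ p ∈ l, p.length = m ∧ ∀ c ∈ p, 0 < c.2) ∧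
  Set.extremePoints ℝ P = {y | ∃ p ∈ l, y = pointOfFractions m p} ∧
  P = convexHull ℝ {y | ∃ p ∈ l, y = pointOfFractions m p}

/-!
The rate vectors of simple solutions are the normalized rate vectors of integral packings. In one
direction the multiplicities of the members of a decomposition form a packing, because the members
using an edge occupy different coordinates of it (`simpleRates_subset`); in the other direction the
members of a packing are run side by side (`parallelCode`). Rounding down the weights of a real
packing and adding one routing solution for each message, which makes all rates positive, shows that
the rates of integral packings are dense in the projected packing polytope (`semiRegion_eq`).
Nondegeneracy and the demand for every message force each partial solution to use an edge, so the
packing polytope is bounded.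

For rationality, the packing polytope is written in the standard form `z ≥ 0`, `B z = c` with slack
variables. The columns of `B` in the support of an extreme point `z` are linearly independent, so
their Gram determinant is nonzero and, by Cramer's rule for the normal equations, a denominator of
`z`. It divides the factorial `commonDen n` of a bound for all such determinants. By the
Krein–Milman theorem the polytope is the convex hull of its points on the grid with this denominator
(`packing_eq_convexHull`).

For computability, only the message set and the set of active edges of a partial solution matter
(its pattern), and a pattern is realizable exactly when there are global coding vectors satisfying
linear conditions at the nodes (`isPattern_description_iff`). Functions between finite sets are
coded by the digits of natural numbers, so realizability and membership in the grid become bounded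
formulas of arithmetic, hence primitive recursive. The region is thus the convex hull of an explicit
finite set of lattice points, up to scaling (`semiRegion_eq_convexHull_gridRates`). A list of points
of this set is its vertex description exactly if every point of the set is a rational convex
combination of the list, and every point of the list is separated from the others by an integral
linear form (`IsVertexCertificate`). The coefficients of such a certificate can be searched for. The
search succeeds for every description, also one that belongs to no network (`exists_certified`), so
it defines a total computable function.
-/

/-! ### Partial scalar-linear solutions as coefficient patterns -/

theorem sum_subtype_eq_sum_ite {I R : Type*} [Fintype I] [AddCommMonoid R] (p : I → Prop)
    [DecidablePred p] [Fintype {i // p i}] (f : I → R) :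
    ∑ i : {i // p i}, f i = ∑ i, if p i then f i else 0 := by
  rw [← Finset.sum_filter]
  exact (Finset.sum_subtype _ (by simp) f).symm

open Classical in
/-- A linear form on a product of lines, indexed by the elements of `I` satisfying `p`, is given by
one coefficient for each index. -/
theorem exists_coeff_of_linear {F : Type*} [Field F] {I : Type*} [Fintype I] (p : I → Prop)
    (f : ((∀ _ : {i // p i}, Fin 1 → F)) →ₗ[F] F) :
    ∃ γ : I → F, ∀ u, f u = ∑ i : {i // p i}, γ i * u i 0 := by
  let ι : ({i // p i} → F) →ₗ[F] (∀ _ : {i // p i}, Fin 1 → F) :=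
    LinearMap.pi fun i => LinearMap.pi fun _ => LinearMap.proj i
  refine ⟨fun i => if h : p i then (f ∘ₗ ι) (fun j => if ⟨i, h⟩ = j then 1 else 0) else 0,
    fun u => ?_⟩
  have hu : u = ι fun i => u i 0 := by
    funext i j
    simp [ι, Subsingleton.elim j 0]
  have h1 := LinearMap.pi_apply_eq_sum_univ (f ∘ₗ ι) fun i => u i 0
  rw [LinearMap.comp_apply, ← hu] at h1
  rw [h1]
  refine Finset.sum_congr rfl fun i _ => ?_
  simp only [dif_pos i.2, smul_eq_mul, Subtype.coe_eta, mul_comm]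

namespace CapNetwork

section Patterns

variable {V E M A : Type*} {F : Type*} [Field F]

open Classical in
/-- The linear combination, with coefficients `γ` and `δ`, of the unit vectors of the messages
generated at the node `x` and of the vectors `g e` of the in-edges `e` of `x`, evaluated at the
message `m`. -/
noncomputable def nodeComb [Fintype E] (N : CapNetwork V E M A) (g : E → M → F) (x : V)
    (γ : M → F) (δ : E → F) (m : M) : F :=
  (if m ∈ N.S x then γ m else 0) + ∑ e, if N.tgt e = x then δ e * g e m else 0

/-- Global coding vectors `g` describe a scalar-linear solution for the messages in `T`: the vector
of every edge and the unit vector of every demand is a combination of what is available at the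
node in question. -/
structure IsCoding [Fintype E] [DecidableEq M] (N : CapNetwork V E M A) (T : Set M)
    (g : E → M → F) : Prop where
  edge : ∀ e, ∃ (γ : M → F) (δ : E → F), ∀ m ∈ T, g e m = N.nodeComb g (N.src e) γ δ m
  demand : ∀ x, ∀ m ∈ N.R x, m ∈ T → ∃ (γ : M → F) (δ : E → F), ∀ m' ∈ T,
    N.nodeComb g x γ δ m' = if m' = m then 1 else 0

variable [Fintype E] [Fintype M]

open Classical in
/-- The linear combination, with coefficients `γ` and `δ`, of the scalar inputs available at the
node `x`. -/
noncomputable def inputComb (N : CapNetwork V E M A) (T : Set M) (x : V) (γ : M → F) (δ : E → F)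
    (u : (N.unitRestrict T).Inputs F (fun _ => 1) 1 x) : F :=
  ∑ m : {m : T // m ∈ (N.unitRestrict T).S x}, γ m.1 * u.1 m 0 +
    ∑ e : {e // (N.unitRestrict T).tgt e = x}, δ e * u.2 e (N.edgeCoord T e)

theorem isLinearMap_inputComb (N : CapNetwork V E M A) (T : Set M) (x : V) (γ : M → F)
    (δ : E → F) : IsLinearMap F (N.inputComb T x γ δ) := by
  refine ⟨fun u v => ?_, fun c u => ?_⟩
  · have h1 : ∀ m, (u + v).1 m 0 = u.1 m 0 + v.1 m 0 := fun _ => rfl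
    have h2 : ∀ e, (u + v).2 e (N.edgeCoord T e) =
      u.2 e (N.edgeCoord T e) + v.2 e (N.edgeCoord T e) := fun _ => rfl
    simp only [inputComb, h1, h2, mul_add, Finset.sum_add_distrib]
    ring
  · have h1 : ∀ m, (c • u).1 m 0 = c * u.1 m 0 := fun _ => rfl
    have h2 : ∀ e, (c • u).2 e (N.edgeCoord T e) = c * u.2 e (N.edgeCoord T e) := fun _ => rfl
    simp only [inputComb, h1, h2, smul_eq_mul, mul_add, Finset.mul_sum, mul_left_comm]

theorem exists_inputComb_eq (N : CapNetwork V E M A) (T : Set M) (x : V)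
    {f : (N.unitRestrict T).Inputs F (fun _ => 1) 1 x → F} (hf : IsLinearMap F f) :
    ∃ γ δ, f = N.inputComb T x γ δ := by
  classical
  obtain ⟨γ, hγ⟩ := exists_coeff_of_linear (fun m : T => m ∈ (N.unitRestrict T).S x)
    (hf.mk' f ∘ₗ LinearMap.inl F _ _)
  obtain ⟨δ, hδ⟩ := exists_coeff_of_linear (fun e => (N.unitRestrict T).tgt e = x)
    (hf.mk' f ∘ₗ LinearMap.inr F _ _)
  refine ⟨fun m => if h : m ∈ T then γ ⟨m, h⟩ else 0, δ, funext fun u => ?_⟩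
  have h1 : f u = f (u.1, 0) + f (0, u.2) := by
    rw [← hf.map_add]
    simp
  rw [h1]
  refine (congrArg₂ (· + ·) (hγ u.1) (hδ u.2)).trans ?_
  simp only [inputComb, Subtype.coe_prop, dif_pos, Subtype.coe_eta]
  rfl

open Classical in
/-- Evaluating a combination of inputs, where the symbols on the edges are the values of global
coding vectors. -/
theorem inputComb_eq_sum (N : CapNetwork V E M A) (T : Set M) (x : V) (γ : M → F) (δ : E → F)
    (g : E → M → F) (a : T → Fin 1 → F) (u : (N.unitRestrict T).Inputs F (fun _ => 1) 1 x)
    (h1 : ∀ m, u.1 m 0 = a m.1 0)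
    (h2 : ∀ e, u.2 e (N.edgeCoord T e) = ∑ m : T, g e m * a m 0) :
    N.inputComb T x γ δ u = ∑ m : T, N.nodeComb g x γ δ m * a m 0 := by
  classical
  simp only [inputComb, h1, h2]
  rw [sum_subtype_eq_sum_ite (fun m : T => m ∈ (N.unitRestrict T).S x)
      (fun m : T => γ m * a m 0),
    sum_subtype_eq_sum_ite (fun e => (N.unitRestrict T).tgt e = x)
      (fun e => δ e * ∑ m : T, g e m * a m 0)]
  have h3 : ∀ m : T, N.nodeComb g x γ δ m * a m 0 =
      (if (m : M) ∈ N.S x then γ m * a m 0 else 0) +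
      ∑ e, if N.tgt e = x then δ e * (g e m * a m 0) else 0 := fun m => by
    rw [nodeComb, add_mul, Finset.sum_mul, ite_mul, zero_mul]
    congr 1
    refine Finset.sum_congr rfl fun e' _ => ?_
    split_ifs <;> ring
  simp only [h3]
  rw [Finset.sum_add_distrib, Finset.sum_comm]
  congr 1
  refine Finset.sum_congr rfl fun e _ => ?_
  by_cases h : N.tgt e = x
  · have h' : (N.unitRestrict T).tgt e = x := h
    simp [h, h', Finset.mul_sum]
  · have h' : ¬ (N.unitRestrict T).tgt e = x := h
    simp [h, h']

open Classical in
/-- The symbol on an edge of a scalar code given by coefficients is the value of the global coding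
vector of the edge at the message assignment. -/
theorem symbol_eq_sum (N : CapNetwork V E M A) (T : Set M)
    (C : (N.unitRestrict T).FracCode F (fun _ => 1) 1) (γ : E → M → F) (δ : E → E → F)
    (hC : ∀ e u, C.edgeFn e u (N.edgeCoord T e) = N.inputComb T (N.src e) (γ e) (δ e) u)
    (g : E → M → F) (hg : ∀ e, ∀ m ∈ T, g e m = N.nodeComb g (N.src e) (γ e) (δ e) m)
    (a : T → Fin 1 → F) (e : E) :
    C.symbol a e (N.edgeCoord T e) = ∑ m : T, g e m * a m 0 := by
  induction e using (N.unitRestrict T).edge_wf.induction with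
  | _ e ih =>
  rw [C.symbol_eq, hC]
  refine Eq.trans
    (N.inputComb_eq_sum T _ _ _ g a _ (fun _ => rfl) fun e' => ih e'.1 e'.2) ?_
  exact Finset.sum_congr rfl fun m _ => by rw [hg e m m.2]

open Classical in
/-- The symbol on an edge is not identically zero exactly when its global coding vector is not
zero. -/
theorem uses_iff (N : CapNetwork V E M A) (T : Set M)
    (C : (N.unitRestrict T).FracCode F (fun _ => 1) 1) (g : E → M → F)
    (hC : ∀ a e, C.symbol a e (N.edgeCoord T e) = ∑ m : T, g e m * a m 0) (e : E) :
    C.Uses e ↔ ∃ m ∈ T, g e m ≠ 0 := by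
  classical
  constructor
  · rintro ⟨a, ha⟩
    by_contra! hcon
    apply ha
    funext j
    have hj : j = N.edgeCoord T e := Subsingleton.elim (α := Fin 1) j _
    rw [hj, hC]
    exact Finset.sum_eq_zero fun m _ => by rw [hcon m m.2, zero_mul]
  · rintro ⟨m, hm, hne⟩
    refine ⟨fun m' _ => if m' = ⟨m, hm⟩ then 1 else 0, fun h0 => hne ?_⟩
    have h1 := congrFun h0 (N.edgeCoord T e)
    rw [hC] at h1
    simpa using h1

/-- Global coding vectors satisfying the local conditions come from a partial scalar-linear
solution. -/
theorem IsCoding.exists_partialSolution [DecidableEq M] {N : CapNetwork V E M A}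
    {T : Set M} {g : E → M → F} (h : N.IsCoding T g) (hT : T.Nonempty)
    (hA : Nat.card A ≤ Nat.card F) :
    ∃ W : N.PartialSolution F, W.T = T ∧ ∀ e, W.code.Uses e ↔ ∃ m ∈ T, g e m ≠ 0 := by
  choose γ δ hg using h.edge
  choose γ' δ' hd using h.demand
  let C : (N.unitRestrict T).FracCode F (fun _ => 1) 1 :=
    { card_le := hA
      edgeFn := fun e u _ => N.inputComb T (N.src e) (γ e) (δ e) u
      decFn := fun x m u _ =>
        N.inputComb T x (γ' x m.1 m.2 m.1.2) (δ' x m.1 m.2 m.1.2) u }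
  have hsym := symbol_eq_sum N T C γ δ (fun e u => rfl) g hg
  refine ⟨⟨T, hT, C, ⟨fun e => ?_, fun x m => ?_⟩, ?_⟩, rfl, uses_iff N T C g hsym⟩
  · have hl := N.isLinearMap_inputComb T (N.src e) (γ e) (δ e)
    exact ⟨fun u v => funext fun _ => hl.map_add u v, fun c u => funext fun _ => hl.map_smul c u⟩
  · have hl := N.isLinearMap_inputComb T x (γ' x m.1 m.2 m.1.2) (δ' x m.1 m.2 m.1.2)
    exact ⟨fun u v => funext fun _ => hl.map_add u v, fun c u => funext fun _ => hl.map_smul c u⟩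
  · intro a x m
    funext j
    have hj : j = 0 := Subsingleton.elim (α := Fin 1) j 0
    subst hj
    refine (N.inputComb_eq_sum T x _ _ g a _ (fun _ => rfl) fun e' => hsym a e'.1).trans ?_
    rw [Finset.sum_eq_single m.1]
    · rw [hd x m.1 m.2 m.1.2 _ m.1.2, if_pos rfl, one_mul]
    · intro b _ hb
      rw [hd x m.1 m.2 m.1.2 _ b.2, if_neg fun hb' => hb (Subtype.ext hb'), zero_mul]
    · simp

/-- The global coding vectors of a partial scalar-linear solution. -/
theorem PartialSolution.exists_isCoding [DecidableEq M] {N : CapNetwork V E M A}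
    (W : N.PartialSolution F) :
    ∃ g : E → M → F, N.IsCoding W.T g ∧ ∀ e, W.code.Uses e ↔ ∃ m ∈ W.T, g e m ≠ 0 := by
  classical
  have hE : ∀ e, ∃ γ δ, (fun u => W.code.edgeFn e u (N.edgeCoord W.T e)) =
      N.inputComb W.T (N.src e) γ δ := fun e =>
    N.exists_inputComb_eq W.T (N.src e) ⟨fun u v => congrFun ((W.linear.1 e).map_add u v) _,
      fun c u => congrFun ((W.linear.1 e).map_smul c u) _⟩
  choose γ δ hγ using hE
  -- The coding vector of an edge lists its symbols under the unit message assignments `b m`.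
  let b : M → W.T → Fin 1 → F := fun m m' _ => if (m' : M) = m then 1 else 0
  let g : E → M → F := fun e m => W.code.symbol (b m) e (N.edgeCoord W.T e)
  have hb : ∀ (φ : M → F) (m : M), m ∈ W.T → ∑ m' : W.T, φ m' * b m m' 0 = φ m := by
    intro φ m hm
    rw [Finset.sum_eq_single ⟨m, hm⟩]
    · simp [b]
    · intro m' _ hne
      have : (m' : M) ≠ m := fun h => hne (Subtype.ext h)
      simp [b, this]
    · simp
  have hg : ∀ e, ∀ m ∈ W.T, g e m = N.nodeComb g (N.src e) (γ e) (δ e) m := by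
    intro e m hm
    have h := congrFun (hγ e) (fun m₁ => b m m₁, fun e' => W.code.symbol (b m) e'.1)
    refine Eq.trans ((W.code.symbol_eq (b m) e).symm ▸ h) ?_
    refine Eq.trans (N.inputComb_eq_sum W.T _ _ _ g (b m) _ (fun _ => rfl)
      fun e' => (hb (g e'.1) m hm).symm) (hb _ m hm)
  have hsym := symbol_eq_sum N W.T W.code γ δ (fun e u => congrFun (hγ e) u) g hg
  refine ⟨g, ⟨fun e => ⟨γ e, δ e, hg e⟩, fun x m hm hmT => ?_⟩, uses_iff N W.T W.code g hsym⟩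
  obtain ⟨γ', δ', h'⟩ := N.exists_inputComb_eq W.T x
    (f := fun u => W.code.decFn x ⟨⟨m, hmT⟩, hm⟩ u 0)
    ⟨fun u v => congrFun ((W.linear.2 x _).map_add u v) _,
      fun c u => congrFun ((W.linear.2 x _).map_smul c u) _⟩
  refine ⟨γ', δ', fun m' hm' => ?_⟩
  have h1 := congrFun (W.solution (b m') x ⟨⟨m, hmT⟩, hm⟩) 0
  have h2 := congrFun h' (fun m₁ => b m' m₁, fun e => W.code.symbol (b m') e.1)
  have h3 := h2.trans (N.inputComb_eq_sum W.T x γ' δ' g (b m') _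
    (fun _ => rfl) fun e => hsym (b m') e.1)
  rw [hb (N.nodeComb g x γ' δ') m' hm'] at h3
  refine h3.symm.trans (h1.trans ?_)
  simp [b, eq_comm]

end Patterns

end CapNetwork

/-! ### Simple solutions and integral packings -/

namespace CapNetwork

section Packing

variable {V E M A : Type*} {F : Type*} [Field F]

/-- Routing: every message alone is transmitted by the scalar code that forwards it along all edges
which can be reached from one of its sources. -/
theorem exists_partialSolution_singleton [Finite E] [Finite M] {N : CapNetwork V E M A}
    (hN : N.Nondegenerate) (hA : Nat.card A ≤ Nat.card F) (m : M) :
    ∃ W : N.PartialSolution F, W.T = {m} := by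
  classical
  have := Fintype.ofFinite E
  have := Fintype.ofFinite M
  let reach : V → Prop := fun x => ∃ y, m ∈ N.S y ∧ Relation.ReflTransGen N.Adj y x
  let g : E → M → F := fun e _ => if reach (N.src e) then 1 else 0
  -- A node that generates `m` uses its own copy; any other node that can be reached copies the
  -- symbol of the last edge of a path from a source.
  have key : ∀ x, ∃ (γ : M → F) (δ : E → F),
      N.nodeComb g x γ δ m = if reach x then 1 else 0 := by
    intro x
    by_cases hS : m ∈ N.S x
    · have hx : reach x := ⟨x, hS, .refl⟩
      exact ⟨1, 0, by simp [nodeComb, hS, hx]⟩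
    · by_cases hx : reach x
      · obtain ⟨y, hy, hyx⟩ := hx
        obtain rfl | ⟨z, hyz, e, rfl, rfl⟩ := Relation.ReflTransGen.cases_tail hyx
        · exact absurd hy hS
        · have h1 : reach (N.src e) := ⟨y, hy, hyz⟩
          have h2 : reach (N.tgt e) := ⟨y, hy, hyx⟩
          refine ⟨0, Pi.single e 1, ?_⟩
          rw [if_pos h2, nodeComb, if_neg hS, zero_add, Finset.sum_eq_single e]
          · simp [g, h1]
          · intro b _ hb
            simp [hb]
          · simp
      · exact ⟨0, 0, by simp [nodeComb, hS, hx]⟩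
  have hg : N.IsCoding {m} g := by
    refine ⟨fun e => ?_, fun x m' hm' hT => ?_⟩
    · obtain ⟨γ, δ, h⟩ := key (N.src e)
      refine ⟨γ, δ, fun m' hm' => ?_⟩
      rw [hm', h]
    · obtain ⟨γ, δ, h⟩ := key x
      refine ⟨γ, δ, fun m'' hm'' => ?_⟩
      obtain rfl : m' = m := hT
      obtain rfl : m'' = m' := hm''
      rw [h, if_pos rfl, if_pos (hN.1 x m'' hm')]
  obtain ⟨W, hW, -⟩ := hg.exists_partialSolution ⟨m, rfl⟩ hA
  exact ⟨W, hW⟩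

/-- A partial scalar-linear solution uses at least one edge. -/
theorem PartialSolution.exists_uses [Finite E] [Finite M] {N : CapNetwork V E M A}
    (hN : N.Nondegenerate) (hD : N.EveryMessageDemanded) (W : N.PartialSolution F) :
    ∃ e, W.code.Uses e := by
  classical
  have := Fintype.ofFinite E
  have := Fintype.ofFinite M
  obtain ⟨g, hg, hu⟩ := W.exists_isCoding
  obtain ⟨m, hm⟩ := W.nonempty
  obtain ⟨x, hx⟩ := hD m
  obtain ⟨γ, δ, h⟩ := hg.demand x m hx hm
  have h1 := h m hm
  rw [if_pos rfl, nodeComb, if_neg fun hS => hN.2 x m hS hx, zero_add] at h1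
  by_contra! hcon
  have h2 : ∀ e, g e m = 0 := fun e => by
    by_contra hne
    exact hcon e ((hu e).2 ⟨m, hm, hne⟩)
  simp [h2] at h1

section Realization

variable [Finite E] {N : CapNetwork V E M A} {k : M → ℕ} {n r : ℕ}
  (W : Fin r → N.PartialSolution F) (σ : ∀ m, Fin (k m) ≃ {t // m ∈ (W t).T})
  (τ : ∀ e, {t // (W t).code.Uses e} ↪ Fin (n * N.cap e))

theorem component_add (x : V) (u v : N.Inputs F k n x) (t : Fin r) :
    component W σ τ x (u + v) t = component W σ τ x u t + component W σ τ x v t := by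
  refine Prod.ext rfl ?_
  funext e j
  show (component W σ τ x (u + v) t).2 e j =
    (component W σ τ x u t).2 e j + (component W σ τ x v t).2 e j
  by_cases h : (W t).code.Uses e.1
  · simp only [component, dif_pos h]
    rfl
  · simp only [component, dif_neg h, add_zero]

theorem component_smul (x : V) (c : F) (u : N.Inputs F k n x) (t : Fin r) :
    component W σ τ x (c • u) t = c • component W σ τ x u t := by
  refine Prod.ext rfl ?_
  funext e j
  show (component W σ τ x (c • u) t).2 e j = c * (component W σ τ x u t).2 e j
  by_cases h : (W t).code.Uses e.1
  · simp only [component, dif_pos h]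
    rfl
  · simp only [component, dif_neg h, mul_zero]

open Classical in
/-- The code that runs the members of a family of partial scalar-linear solutions side by side on
the coordinates allocated to them. -/
noncomputable def parallelCode (hA : Nat.card A ≤ Nat.card F) : N.FracCode F k n where
  card_le := hA
  edgeFn e u j := if h : ∃ t, τ e t = j then
    (W h.choose).code.edgeFn e (component W σ τ (N.src e) u h.choose) (N.edgeCoord (W h.choose).T e)
    else 0
  decFn x m u i :=
    (W (σ m i)).code.decFn x ⟨⟨m, (σ m i).2⟩, m.2⟩ (component W σ τ x u (σ m i)) 0

theorem parallelCode_edgeFn (hA : Nat.card A ≤ Nat.card F) (e : E) (u : N.Inputs F k n (N.src e))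
    (t : {t // (W t).code.Uses e}) :
    (parallelCode W σ τ hA).edgeFn e u (τ e t) =
      (W t).code.edgeFn e (component W σ τ (N.src e) u t) (N.edgeCoord (W t).T e) := by
  have h : ∃ t', τ e t' = τ e t := ⟨t, rfl⟩
  have ht : h.choose = t := (τ e).injective h.choose_spec
  simp only [parallelCode]
  rw [dif_pos h, ht]

theorem parallelCode_edgeFn_of_notMem (hA : Nat.card A ≤ Nat.card F) (e : E)
    (u : N.Inputs F k n (N.src e)) {j : Fin (n * N.cap e)} (hj : j ∉ Set.range (τ e)) :
    (parallelCode W σ τ hA).edgeFn e u j = 0 := by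
  simp only [parallelCode]
  rw [dif_neg (show ¬ ∃ t, τ e t = j from hj)]

theorem parallelCode_isLinear (hA : Nat.card A ≤ Nat.card F) :
    (parallelCode W σ τ hA).IsLinear := by
  refine ⟨fun e => ⟨fun u v => ?_, fun c u => ?_⟩, fun x m => ⟨fun u v => ?_, fun c u => ?_⟩⟩
  · funext j
    by_cases hj : j ∈ Set.range (τ e)
    · obtain ⟨t, rfl⟩ := hj
      rw [Pi.add_apply, parallelCode_edgeFn, parallelCode_edgeFn, parallelCode_edgeFn,
        component_add]
      exact congrFun (((W t).linear.1 e).map_add _ _) _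
    · rw [Pi.add_apply, parallelCode_edgeFn_of_notMem W σ τ hA e _ hj,
        parallelCode_edgeFn_of_notMem W σ τ hA e _ hj,
        parallelCode_edgeFn_of_notMem W σ τ hA e _ hj, add_zero]
  · funext j
    by_cases hj : j ∈ Set.range (τ e)
    · obtain ⟨t, rfl⟩ := hj
      rw [Pi.smul_apply, parallelCode_edgeFn, parallelCode_edgeFn, component_smul]
      exact congrFun (((W t).linear.1 e).map_smul _ _) _
    · rw [Pi.smul_apply, parallelCode_edgeFn_of_notMem W σ τ hA e _ hj,
        parallelCode_edgeFn_of_notMem W σ τ hA e _ hj, smul_zero]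
  · funext i
    show (W (σ m i)).code.decFn x _ (component W σ τ x (u + v) (σ m i)) 0 = _
    rw [component_add]
    exact congrFun (((W (σ m i)).linear.2 x _).map_add _ _) _
  · funext i
    show (W (σ m i)).code.decFn x _ (component W σ τ x (c • u) (σ m i)) 0 = _
    rw [component_smul]
    exact congrFun (((W (σ m i)).linear.2 x _).map_smul _ _) _

/-- The part of a message assignment that belongs to one member of the family. -/
def memberAssignment (a : ∀ m, Fin (k m) → F) (t : Fin r) : (W t).T → Fin 1 → F :=
  fun m _ => a m ((σ m).symm ⟨t, m.2⟩)

theorem component_of_symbol (a : ∀ m, Fin (k m) → F) (s : ∀ e, Fin (n * N.cap e) → F) (x : V)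
    (t : Fin r)
    (hs : ∀ e (h : (W t).code.Uses e), N.tgt e = x → s e (τ e ⟨t, h⟩) =
      (W t).code.symbol (memberAssignment W σ a t) e (N.edgeCoord (W t).T e)) :
    component W σ τ x (fun m => a m, fun e => s e.1) t =
      ((fun m => memberAssignment W σ a t m.1,
        fun e => (W t).code.symbol (memberAssignment W σ a t) e.1) :
        (N.unitRestrict (W t).T).Inputs F (fun _ => 1) 1 x) := by
  refine Prod.ext rfl ?_
  funext e j
  have hj : j = N.edgeCoord (W t).T e := Subsingleton.elim (α := Fin 1) _ _
  subst hj
  by_cases h : (W t).code.Uses e.1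
  · simp only [component, dif_pos h]
    exact hs e.1 h e.2
  · have h0 : (W t).code.symbol (memberAssignment W σ a t) e.1 = 0 := by
      by_contra hne
      exact h ⟨_, hne⟩
    simp only [component, dif_neg h, h0]
    rfl

theorem parallelCode_symbol (hA : Nat.card A ≤ Nat.card F) (a : ∀ m, Fin (k m) → F) (e : E) :
    ∀ (t : Fin r) (h : (W t).code.Uses e), (parallelCode W σ τ hA).symbol a e (τ e ⟨t, h⟩) =
      (W t).code.symbol (memberAssignment W σ a t) e (N.edgeCoord (W t).T e) := by
  induction e using N.edge_wf.induction with
  | _ e ih =>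
  intro t h
  rw [FracCode.symbol_eq, parallelCode_edgeFn]
  refine Eq.trans ?_ (congrFun ((W t).code.symbol_eq (memberAssignment W σ a t) e).symm _)
  refine congrFun (congrArg _ ?_) _
  exact component_of_symbol W σ τ a _ (N.src e) t fun e' h' he' => ih e' he' t h'

theorem parallelCode_isSimple (hA : Nat.card A ≤ Nat.card F) :
    (parallelCode W σ τ hA).IsSimple := by
  refine ⟨parallelCode_isLinear W σ τ hA, fun a x m => ?_, r, W, σ, τ,
    parallelCode_edgeFn W σ τ hA, fun e u j hj => parallelCode_edgeFn_of_notMem W σ τ hA e u hj,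
    fun x m u i => rfl⟩
  funext i
  show (W (σ m i)).code.decFn x ⟨⟨m, (σ m i).2⟩, m.2⟩ (component W σ τ x _ (σ m i)) 0 = _
  rw [component_of_symbol W σ τ a _ x (σ m i) fun e h _ => parallelCode_symbol W σ τ hA a e _ h]
  refine (congrFun ((W (σ m i)).solution (memberAssignment W σ a (σ m i)) x
    ⟨⟨m, (σ m i).2⟩, m.2⟩) 0).trans ?_
  simp [memberAssignment]

end Realization

variable [Finite V] [Finite E] [Finite M] [Finite F] {N : CapNetwork V E M A}

open Classical in
/-- A packing of partial scalar-linear solutions with integral multiplicities is realized by a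
simple solution. -/
theorem mem_simpleRates_of_packing (hA : Nat.card A ≤ Nat.card F) (x : N.PartialSolution F → ℕ)
    {n : ℕ} (hn : 0 < n)
    (hx : ∀ e, ∑ W, (if W.code.Uses e then x W else 0) ≤ n * N.cap e)
    (hpos : ∀ m, 0 < ∑ W, (if m ∈ W.T then x W else 0)) :
    (fun m => ((∑ W, (if m ∈ W.T then x W else 0) : ℕ) : ℝ) / n) ∈ N.simpleRates F := by
  -- The members of the family are the copies of partial solutions, as many as `x` prescribes.
  let ι : Fin (Fintype.card (Σ W, Fin (x W))) ≃ Σ W, Fin (x W) := (Fintype.equivFin _).symm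
  let W : Fin (Fintype.card (Σ W, Fin (x W))) → N.PartialSolution F := fun t => (ι t).1
  have hcard : ∀ p : N.PartialSolution F → Prop,
      Fintype.card {t // p (W t)} = ∑ W, if p W then x W else 0 := by
    intro p
    rw [Fintype.card_congr (ι.subtypeEquiv (q := fun s => p s.1) fun t => Iff.rfl),
      Fintype.card_subtype, Finset.card_filter, Fintype.sum_sigma]
    refine Finset.sum_congr rfl fun W _ => ?_
    split_ifs <;> simp
  have hσ : ∀ m, Nonempty (Fin (∑ W, (if m ∈ W.T then x W else 0)) ≃ {t // m ∈ (W t).T}) :=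
    fun m => ⟨Fintype.equivOfCardEq (by rw [Fintype.card_fin, hcard fun W => m ∈ W.T])⟩
  have hτ : ∀ e, Nonempty ({t // (W t).code.Uses e} ↪ Fin (n * N.cap e)) := fun e =>
    Function.Embedding.nonempty_of_card_le (by
      rw [Fintype.card_fin, hcard fun W => W.code.Uses e]
      exact hx e)
  let σ := fun m => (hσ m).some
  let τ := fun e => (hτ e).some
  exact ⟨_, n, parallelCode W σ τ hA, hpos, hn, parallelCode_isSimple W σ τ hA, rfl⟩

/-- The multiplicities of the members of a simple solution form a packing. -/
theorem simpleRates_subset : N.simpleRates F ⊆ N.rateMap F '' N.packingPolytope F := by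
  classical
  rintro ρ ⟨k, n, C, -, hn, ⟨-, -, r, W, σ, τ, -⟩, rfl⟩
  have hn' : (0 : ℝ) < n := Nat.cast_pos.2 hn
  have hcard : ∀ p : N.PartialSolution F → Prop,
      ∑ W', (if p W' then 1 else 0) * ((Fintype.card {t // W t = W'} : ℝ) / n) =
        (Fintype.card {t // p (W t)} : ℝ) / n := by
    intro p
    simp only [Fintype.card_subtype, Finset.card_filter, Nat.cast_sum, Finset.sum_div,
      Finset.mul_sum]
    rw [Finset.sum_comm]
    refine Finset.sum_congr rfl fun t _ => ?_
    rw [Finset.sum_eq_single (W t)]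
    · by_cases h : p (W t) <;> simp [h]
    · intro b _ hb
      simp [hb.symm]
    · simp
  refine ⟨fun W' => (Fintype.card {t // W t = W'} : ℝ) / n, ⟨fun _ => by positivity, fun e => ?_⟩,
    funext fun m => ?_⟩
  · refine le_of_eq_of_le (hcard fun W' => W'.code.Uses e) ?_
    rw [div_le_iff₀ hn', mul_comm]
    have h := Fintype.card_le_of_embedding (τ e)
    rw [Fintype.card_fin] at h
    exact_mod_cast h
  · refine (hcard fun W' => m ∈ W'.T).trans ?_
    rw [← Fintype.card_congr (σ m), Fintype.card_fin]

end Packing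

end CapNetwork

/-! ### Extreme points of integral polyhedra -/

open scoped Nat in
/-- A common denominator of the extreme points of the polyhedra `z ≥ 0`, `B z = c`, where `B` and
`c` are integral, `B` has at most `n` rows, at most `n` columns, and entries of absolute value at
most one. The factorial makes it a multiple of every determinant that occurs in Cramer's rule. -/
def commonDen (n : ℕ) : ℕ := (n ! * (n + 1) ^ n)!

theorem commonDen_pos (n : ℕ) : 0 < commonDen n := Nat.factorial_pos _

section StandardForm

variable {ι κ : Type*} [Fintype κ]

/-- The polyhedron of the nonnegative solutions of an integral system of linear equations. -/
def standardPolyhedron (B : Matrix ι κ ℤ) (c : ι → ℤ) : Set (κ → ℝ) :=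
  {z | (∀ j, 0 ≤ z j) ∧ ∀ i, ∑ j, (B i j : ℝ) * z j = c i}

theorem convex_standardPolyhedron (B : Matrix ι κ ℤ) (c : ι → ℤ) :
    Convex ℝ (standardPolyhedron B c) := by
  intro x hx y hy a b ha hb hab
  refine ⟨fun j => ?_, fun i => ?_⟩
  · exact add_nonneg (mul_nonneg ha (hx.1 j)) (mul_nonneg hb (hy.1 j))
  · have h : ∀ j, (B i j : ℝ) * (a • x + b • y) j =
        a * ((B i j : ℝ) * x j) + b * ((B i j : ℝ) * y j) := fun j => by
      simp only [Pi.add_apply, Pi.smul_apply, smul_eq_mul]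
      ring
    rw [Finset.sum_congr rfl fun j _ => h j, Finset.sum_add_distrib, ← Finset.mul_sum,
      ← Finset.mul_sum, hx.2, hy.2, ← add_mul, hab, one_mul]

theorem isClosed_standardPolyhedron (B : Matrix ι κ ℤ) (c : ι → ℤ) :
    IsClosed (standardPolyhedron B c) := by
  have h : standardPolyhedron B c =
      (⋂ j, {z : κ → ℝ | 0 ≤ z j}) ∩ ⋂ i, {z | ∑ j, (B i j : ℝ) * z j = c i} := by
    ext z
    simp [standardPolyhedron]
  rw [h]
  exact (isClosed_iInter fun j => isClosed_le (by fun_prop) (by fun_prop)).inter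
    (isClosed_iInter fun i => isClosed_eq (by fun_prop) (by fun_prop))

open Classical in
/-- The columns of the system in the support of an extreme point are linearly independent, hence
their Gram determinant does not vanish. By Cramer's rule for the normal equations it is a
denominator of the extreme point. -/
theorem exists_det_of_mem_extremePoints [Fintype ι] (B : Matrix ι κ ℤ) (c : ι → ℤ) {z : κ → ℝ}
    (hz : z ∈ Set.extremePoints ℝ (standardPolyhedron B c)) :
    ((B.submatrix id (Subtype.val : {j // z j ≠ 0} → κ)).transpose *
        B.submatrix id (Subtype.val : {j // z j ≠ 0} → κ)).det ≠ 0 ∧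
    ∀ j, ∃ t : ℤ, ((((B.submatrix id (Subtype.val : {j // z j ≠ 0} → κ)).transpose *
        B.submatrix id (Subtype.val : {j // z j ≠ 0} → κ)).det : ℤ) : ℝ) * z j = t := by
  set B' : Matrix ι {j // z j ≠ 0} ℤ := B.submatrix id Subtype.val
  obtain ⟨⟨hz0, hzc⟩, hext⟩ := mem_extremePoints_iff_left.1 hz
  let R : Matrix ι {j // z j ≠ 0} ℝ := B'.map (Int.castRingHom ℝ)
  have hR : R.transpose * R = (B'.transpose * B').map (Int.castRingHom ℝ) := by
    rw [Matrix.map_mul, Matrix.transpose_map]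
  have hdet : (R.transpose * R).det = ((B'.transpose * B').det : ℤ) := by
    rw [hR]
    exact ((Int.castRingHom ℝ).map_det _).symm
  have hsub : ∀ (f : κ → ℝ), (∀ j, z j = 0 → f j = 0) → ∑ j : {j // z j ≠ 0}, f j = ∑ j, f j := by
    intro f hf
    rw [sum_subtype_eq_sum_ite (fun j => z j ≠ 0) f]
    refine Finset.sum_congr rfl fun j _ => ?_
    by_cases h : z j = 0 <;> simp [h, hf j]
  refine ⟨fun h0 => ?_, ?_⟩
  · obtain ⟨v, hv, hRv⟩ := Matrix.exists_mulVec_eq_zero_iff.2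
      (show (R.transpose * R).det = 0 by rw [hdet, h0, Int.cast_zero])
    have hv0 : R.mulVec v = 0 := by
      have := (Matrix.conjTranspose_mul_self_mulVec_eq_zero R v).1
      rw [Matrix.conjTranspose_eq_transpose_of_trivial] at this
      exact this hRv
    let w : κ → ℝ := fun j => if h : z j ≠ 0 then v ⟨j, h⟩ else 0
    have hw0 : ∀ j, z j = 0 → w j = 0 := fun j h => dif_neg (not_not.2 h)
    have hw1 : ∀ j : {j // z j ≠ 0}, w j = v j := fun j => dif_pos j.2
    have hBw : ∀ i, ∑ j, (B i j : ℝ) * w j = 0 := by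
      intro i
      rw [← hsub (fun j => (B i j : ℝ) * w j) fun j hj => by rw [hw0 j hj, mul_zero]]
      refine Eq.trans ?_ (congrFun hv0 i)
      exact Finset.sum_congr rfl fun j _ => by rw [hw1]; rfl
    -- A small multiple of the kernel vector `w` can be added to and subtracted from `z`.
    have hε : ∃ ε > 0, ∀ j, ε * |w j| ≤ z j := by
      have hev : ∀ᶠ ε in nhdsWithin (0 : ℝ) (Set.Ioi 0), ∀ j, ε * |w j| ≤ z j := by
        rw [Filter.eventually_all]
        intro j
        by_cases hj : z j = 0
        · exact Filter.Eventually.of_forall fun ε => by rw [hw0 j hj, abs_zero, mul_zero, hj]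
        · have hpos : 0 < z j := lt_of_le_of_ne (hz0 j) (Ne.symm hj)
          have ht : Filter.Tendsto (fun ε : ℝ => ε * |w j|) (nhdsWithin 0 (Set.Ioi 0))
              (nhds (0 * |w j|)) :=
            ((continuous_id.mul continuous_const).tendsto 0).mono_left nhdsWithin_le_nhds
          rw [zero_mul] at ht
          exact (ht.eventually (eventually_lt_nhds hpos)).mono fun _ h => h.le
      obtain ⟨ε, h1, h2⟩ := (hev.and self_mem_nhdsWithin).exists
      exact ⟨ε, h2, h1⟩
    obtain ⟨ε, hε0, hε⟩ := hε
    have hmem : ∀ s : ℝ, |s| = ε → z + s • w ∈ standardPolyhedron B c := by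
      intro s hs
      refine ⟨fun j => ?_, fun i => ?_⟩
      · have h1 := hε j
        rw [← hs, ← abs_mul] at h1
        have h2 := neg_abs_le (s * w j)
        simp only [Pi.add_apply, Pi.smul_apply, smul_eq_mul]
        linarith
      · have h : ∀ j, (B i j : ℝ) * (z + s • w) j =
            (B i j : ℝ) * z j + s * ((B i j : ℝ) * w j) := fun j => by
          simp only [Pi.add_apply, Pi.smul_apply, smul_eq_mul]
          ring
        rw [Finset.sum_congr rfl fun j _ => h j, Finset.sum_add_distrib, ← Finset.mul_sum, hBw,
          hzc, mul_zero, add_zero]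
    have h1 := hext _ (hmem ε (abs_of_pos hε0)) _ (hmem (-ε) (by rw [abs_neg, abs_of_pos hε0]))
      ⟨1 / 2, 1 / 2, by norm_num, by norm_num, by norm_num, by module⟩
    have h2 : ε • w = 0 := by simpa using h1
    have h3 : w = 0 := (smul_eq_zero.1 h2).resolve_left hε0.ne'
    exact hv (funext fun j => by rw [← hw1, h3]; rfl)
  · let z' : {j // z j ≠ 0} → ℝ := fun j => z j
    have hRz : R.mulVec z' = fun i => (c i : ℝ) := by
      funext i
      rw [← hzc i, ← hsub _ fun j hj => by rw [hj, mul_zero]]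
      rfl
    have hcram : (R.transpose * R).det • z' =
        fun j => ((((B'.transpose * B').adjugate.mulVec (B'.transpose.mulVec c)) j : ℤ) : ℝ) := by
      have h1 : (R.transpose * R).adjugate.mulVec (R.transpose.mulVec (R.mulVec z')) =
          (R.transpose * R).det • z' := by
        rw [Matrix.mulVec_mulVec, Matrix.mulVec_mulVec, Matrix.mul_assoc, Matrix.adjugate_mul,
          Matrix.smul_mulVec, Matrix.one_mulVec]
      rw [← h1, hRz, hR]
      funext j
      rw [← RingHom.mapMatrix_apply, ← RingHom.map_adjugate, RingHom.mapMatrix_apply]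
      refine Eq.trans ?_ (RingHom.map_mulVec (Int.castRingHom ℝ) (B'.transpose * B').adjugate
        (B'.transpose.mulVec c) j).symm
      refine congrFun (congrArg _ (funext fun i => ?_)) j
      exact (RingHom.map_mulVec (Int.castRingHom ℝ) B'.transpose c i).symm
    intro j
    by_cases hj : z j = 0
    · exact ⟨0, by rw [hj, mul_zero, Int.cast_zero]⟩
    · exact ⟨_, hdet ▸ congrFun hcram ⟨j, hj⟩⟩

end StandardForm

/-! ### Vertices with a common denominator -/

section Vertices

/-- The Gram determinants of the matrices in question are bounded through the Leibniz formula. -/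
theorem dvd_commonDen {ι κ : Type*} [Fintype ι] [Fintype κ] [DecidableEq κ] (B : Matrix ι κ ℤ)
    (hB : ∀ i j, |B i j| ≤ 1) {n : ℕ} (hι : Fintype.card ι ≤ n) (hκ : Fintype.card κ ≤ n)
    (h0 : (B.transpose * B).det ≠ 0) : (B.transpose * B).det ∣ (commonDen n : ℤ) := by
  have hent : ∀ i j, AbsoluteValue.abs ((B.transpose * B) i j) ≤ ((n + 1 : ℕ) : ℤ) := by
    intro i j
    rw [AbsoluteValue.abs_apply, Matrix.mul_apply]
    refine (Finset.abs_sum_le_sum_abs _ _).trans ?_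
    refine (Finset.sum_le_sum (g := fun _ => 1) fun l _ => ?_).trans ?_
    · rw [abs_mul]
      exact mul_le_one₀ (hB _ _) (abs_nonneg _) (hB _ _)
    · simp only [Finset.sum_const, Finset.card_univ, mul_one, nsmul_eq_mul]
      exact_mod_cast hι.trans (Nat.le_succ n)
  have h1 := Matrix.det_le hent
  rw [AbsoluteValue.abs_apply, nsmul_eq_mul] at h1
  have h2 : (B.transpose * B).det.natAbs ≤ n.factorial * (n + 1) ^ n := by
    have h3 : (B.transpose * B).det.natAbs ≤
        (Fintype.card κ).factorial * (n + 1) ^ Fintype.card κ := by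
      have : ((B.transpose * B).det.natAbs : ℤ) = |(B.transpose * B).det| := Int.natCast_natAbs _
      rw [← this] at h1
      exact_mod_cast h1
    exact h3.trans (Nat.mul_le_mul (Nat.factorial_le hκ)
      (Nat.pow_le_pow_right (Nat.succ_pos n) hκ))
  rw [← Int.natAbs_dvd_natAbs, Int.natAbs_natCast]
  exact Nat.dvd_factorial (Int.natAbs_pos.2 h0) h2

theorem exists_nat_of_mem_extremePoints {ι κ : Type*} [Fintype ι] [Fintype κ] (B : Matrix ι κ ℤ)
    (c : ι → ℤ) (hB : ∀ i j, |B i j| ≤ 1) {n : ℕ} (hι : Fintype.card ι ≤ n)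
    (hκ : Fintype.card κ ≤ n) {z : κ → ℝ}
    (hz : z ∈ Set.extremePoints ℝ (standardPolyhedron B c)) :
    ∃ w : κ → ℕ, ∀ j, z j = w j / commonDen n := by
  classical
  obtain ⟨h0, hint⟩ := exists_det_of_mem_extremePoints B c hz
  obtain ⟨q, hq⟩ := dvd_commonDen (B.submatrix id (Subtype.val : {j // z j ≠ 0} → κ))
    (fun i j => hB i j.1) hι
    ((Fintype.card_subtype_le _).trans hκ) h0
  have hD : (0 : ℝ) < commonDen n := Nat.cast_pos.2 (commonDen_pos n)
  have : ∀ j, ∃ w : ℕ, z j = w / commonDen n := by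
    intro j
    obtain ⟨t, ht⟩ := hint j
    have h1 : (commonDen n : ℝ) * z j = ((q * t : ℤ) : ℝ) := by
      have h2 : (commonDen n : ℝ) = ((commonDen n : ℤ) : ℝ) := by simp
      rw [h2, hq, Int.cast_mul, Int.cast_mul, ← ht]
      ring
    have h3 : 0 ≤ q * t := by
      have : (0 : ℝ) ≤ ((q * t : ℤ) : ℝ) := h1 ▸ mul_nonneg hD.le (hz.1.1 j)
      exact_mod_cast this
    refine ⟨(q * t).toNat, ?_⟩
    rw [eq_div_iff hD.ne', mul_comm, h1]
    have : (((q * t).toNat : ℤ) : ℝ) = ((q * t : ℤ) : ℝ) := by rw [Int.toNat_of_nonneg h3]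
    rw [← this, Int.cast_natCast]
  choose w hw using this
  exact ⟨w, hw⟩

/-- A bounded set has only finitely many points on a grid. -/
theorem finite_grid_points {κ : Type*} [Finite κ] {S : Set (κ → ℝ)} (hS : Bornology.IsBounded S)
    (D : ℕ) (hD : 0 < D) : {z ∈ S | ∃ w : κ → ℕ, ∀ j, z j = w j / D}.Finite := by
  have := Fintype.ofFinite κ
  classical
  obtain ⟨r, hr⟩ := hS.exists_norm_le
  have hD' : (0 : ℝ) < D := Nat.cast_pos.2 hD
  refine (Set.Finite.image (fun (w : κ → ℕ) j => (w j : ℝ) / D)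
    (Set.finite_Icc 0 fun _ => ⌈r * D⌉₊)).subset ?_
  rintro z ⟨hz, w, hw⟩
  refine ⟨w, ⟨fun _ => Nat.zero_le _, fun j => ?_⟩, (funext hw).symm⟩
  have h1 := (norm_le_pi_norm z j).trans (hr z hz)
  rw [Real.norm_eq_abs, hw j] at h1
  have h2 := (le_abs_self _).trans h1
  rw [div_le_iff₀ hD'] at h2
  exact_mod_cast h2.trans (Nat.le_ceil _)

/-- A bounded polyhedron in standard form with small integral coefficients is the convex hull of
its points on an explicit grid. -/
theorem standardPolyhedron_eq_convexHull {ι κ : Type*} [Fintype ι] [Fintype κ] (B : Matrix ι κ ℤ)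
    (c : ι → ℤ) (hB : ∀ i j, |B i j| ≤ 1) {n : ℕ} (hι : Fintype.card ι ≤ n)
    (hκ : Fintype.card κ ≤ n) (hb : Bornology.IsBounded (standardPolyhedron B c)) :
    standardPolyhedron B c = convexHull ℝ {z ∈ standardPolyhedron B c |
      ∃ w : κ → ℕ, ∀ j, z j = w j / commonDen n} := by
  refine Set.Subset.antisymm ?_ (convexHull_min (fun z hz => hz.1)
    (convex_standardPolyhedron B c))
  have hc : IsCompact (standardPolyhedron B c) :=
    Metric.isCompact_of_isClosed_isBounded (isClosed_standardPolyhedron B c) hb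
  nth_rewrite 1 [← closure_convexHull_extremePoints hc (convex_standardPolyhedron B c)]
  refine closure_minimal (convexHull_mono fun z hz => ⟨hz.1, ?_⟩)
    ((finite_grid_points hb _ (commonDen_pos n)).isClosed_convexHull ℝ)
  exact exists_nat_of_mem_extremePoints B c hB hι hκ hz

/-- A packing polytope: nonnegative weights on `I` such that at every `e` the total weight of the
members using `e` is at most the capacity. -/
def packing {I E : Type*} [Fintype I] (a : I → E → Prop) [∀ i e, Decidable (a i e)] (cap : E → ℕ) :
    Set (I → ℝ) :=
  {x | (∀ i, 0 ≤ x i) ∧ ∀ e, ∑ i, (if a i e then 1 else 0) * x i ≤ cap e}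

variable {I E : Type*} [Fintype I] {a : I → E → Prop} [∀ i e, Decidable (a i e)] {cap : E → ℕ}

theorem le_cap_of_mem_packing {x : I → ℝ} (hx : x ∈ packing a cap) {i : I} {e : E} (h : a i e) :
    x i ≤ cap e := by
  refine le_trans ?_ (hx.2 e)
  refine le_of_eq_of_le ?_ (Finset.single_le_sum
    (f := fun i => (if a i e then 1 else 0) * x i) (fun j _ => ?_) (Finset.mem_univ i))
  · simp [h]
  · exact mul_nonneg (by split_ifs <;> norm_num) (hx.1 j)

theorem isBounded_packing [Finite E] (ha : ∀ i, ∃ e, a i e) :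
    Bornology.IsBounded (packing a cap) := by
  have := Fintype.ofFinite E
  refine (Metric.isBounded_Icc (0 : I → ℝ) (fun _ => ∑ e, (cap e : ℝ))).subset fun x hx =>
    ⟨hx.1, fun i => ?_⟩
  obtain ⟨e, he⟩ := ha i
  exact (le_cap_of_mem_packing hx he).trans (Finset.single_le_sum (f := fun e => (cap e : ℝ))
    (fun _ _ => Nat.cast_nonneg _) (Finset.mem_univ e))

theorem isClosed_packing : IsClosed (packing a cap) := by
  have h : packing a cap = (⋂ i, {x : I → ℝ | 0 ≤ x i}) ∩
      ⋂ e, {x | ∑ i, (if a i e then 1 else 0) * x i ≤ (cap e : ℝ)} := by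
    ext x
    simp [packing]
  rw [h]
  exact (isClosed_iInter fun i => isClosed_le (by fun_prop) (by fun_prop)).inter
    (isClosed_iInter fun e => isClosed_le (by fun_prop) (by fun_prop))

/-- A packing polytope is the convex hull of its points on an explicit grid: introducing slack
variables brings it into standard form. -/
theorem packing_eq_convexHull [Fintype E] (ha : ∀ i, ∃ e, a i e) {n : ℕ}
    (hn : Fintype.card I + Fintype.card E ≤ n) :
    packing a cap = convexHull ℝ {x ∈ packing a cap |
      ∃ w : I → ℕ, ∀ i, x i = w i / commonDen n} := by
  classical
  let B : Matrix E (I ⊕ E) ℤ := fun e =>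
    Sum.elim (fun i => if a i e then 1 else 0) (fun e' => if e = e' then 1 else 0)
  let c : E → ℤ := fun e => cap e
  let π : (I ⊕ E → ℝ) →ₗ[ℝ] (I → ℝ) := LinearMap.funLeft ℝ ℝ Sum.inl
  have hrow : ∀ (z : I ⊕ E → ℝ) e, ∑ j, (B e j : ℝ) * z j =
      ∑ i, (if a i e then 1 else 0) * z (Sum.inl i) + z (Sum.inr e) := by
    intro z e
    rw [Fintype.sum_sum_type]
    congr 1
    · exact Finset.sum_congr rfl fun i _ => by simp [B]
    · simp [B]
  have himg : π '' standardPolyhedron B c = packing a cap := by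
    ext x
    constructor
    · rintro ⟨z, hz, rfl⟩
      refine ⟨fun i => hz.1 _, fun e => ?_⟩
      have h1 := hz.2 e
      rw [hrow] at h1
      have h2 := hz.1 (Sum.inr e)
      simp only [c, Int.cast_natCast] at h1
      show ∑ i, (if a i e then 1 else 0) * z (Sum.inl i) ≤ _
      linarith
    · intro hx
      refine ⟨Sum.elim x fun e => cap e - ∑ i, (if a i e then 1 else 0) * x i, ⟨?_, fun e => ?_⟩,
        rfl⟩
      · rintro (i | e)
        · exact hx.1 i
        · exact sub_nonneg.2 (hx.2 e)
      · rw [hrow]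
        simp [c]
  have hb : Bornology.IsBounded (standardPolyhedron B c) := by
    refine (Metric.isBounded_Icc (0 : I ⊕ E → ℝ) (fun _ => ∑ e, (cap e : ℝ))).subset fun z hz =>
      ⟨hz.1, ?_⟩
    have hx : π z ∈ packing a cap := himg ▸ ⟨z, hz, rfl⟩
    have hcap : ∀ e, (cap e : ℝ) ≤ ∑ e, (cap e : ℝ) := fun e =>
      Finset.single_le_sum (f := fun e => (cap e : ℝ)) (fun _ _ => Nat.cast_nonneg _)
        (Finset.mem_univ e)
    rintro (i | e)
    · obtain ⟨e, he⟩ := ha i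
      exact (le_cap_of_mem_packing hx he).trans (hcap e)
    · have h1 := hz.2 e
      rw [hrow] at h1
      have h2 : 0 ≤ ∑ i, (if a i e then 1 else 0) * z (Sum.inl i) :=
        Finset.sum_nonneg fun i _ => mul_nonneg (by split_ifs <;> norm_num) (hz.1 _)
      simp only [c, Int.cast_natCast] at h1
      exact le_trans (by linarith) (hcap e)
  have hB : ∀ e j, |B e j| ≤ 1 := by
    rintro e (i | e')
    · by_cases h : a i e <;> simp [B, h]
    · by_cases h : e = e' <;> simp [B, h]
  have hhull := standardPolyhedron_eq_convexHull B c hB (n := n)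
    ((Nat.le_add_left _ _).trans hn) (by rwa [Fintype.card_sum]) hb
  refine Set.Subset.antisymm ?_ (convexHull_min (fun x hx => hx.1) ?_)
  · conv_lhs => rw [← himg, hhull, π.image_convexHull]
    refine convexHull_mono ?_
    rintro _ ⟨z, ⟨hz, w, hw⟩, rfl⟩
    exact ⟨himg ▸ ⟨z, hz, rfl⟩, fun i => w (Sum.inl i), fun i => hw _⟩
  · rw [← himg]
    exact (convex_standardPolyhedron B c).linear_image π

/-- A point with integral coordinates in the convex hull of points with integral coordinates is a
combination of these with rational weights: the polytope of all weights has an extreme point. -/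
theorem exists_nat_weights {ι κ : Type*} [Fintype ι] [Fintype κ] (v : κ → ι → ℕ) (y : ι → ℕ)
    (h : (fun i => (y i : ℝ)) ∈ convexHull ℝ (Set.range fun k i => (v k i : ℝ))) :
    ∃ w : κ → ℕ, 0 < ∑ k, w k ∧ ∀ i, ∑ k, w k * v k i = (∑ k, w k) * y i := by
  classical
  let B : Matrix (Option ι) κ ℤ := fun o k => o.elim 1 fun i => v k i
  let c : Option ι → ℤ := fun o => o.elim 1 fun i => y i
  have hone : ∀ z ∈ standardPolyhedron B c, ∑ k, z k = 1 := by
    intro z hz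
    simpa [B, c] using hz.2 none
  have hc : IsCompact (standardPolyhedron B c) := by
    refine Metric.isCompact_of_isClosed_isBounded (isClosed_standardPolyhedron B c)
      ((Metric.isBounded_Icc (0 : κ → ℝ) 1).subset fun z hz => ⟨hz.1, fun k => ?_⟩)
    exact (Finset.single_le_sum (fun k _ => hz.1 k) (Finset.mem_univ k)).trans_eq (hone z hz)
  have hne : (standardPolyhedron B c).Nonempty := by
    rw [convexHull_range_eq_exists_affineCombination] at h
    obtain ⟨s, w, hw0, hw1, hw⟩ := h
    rw [Finset.affineCombination_eq_linear_combination _ _ _ hw1] at hw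
    refine ⟨fun k => if k ∈ s then w k else 0, fun k => ?_, ?_⟩
    · by_cases hk : k ∈ s
      · simpa [hk] using hw0 k hk
      · simp [hk]
    · rintro (_ | i)
      · simpa [B, c] using hw1
      · have := congrFun hw i
        simp only [Finset.sum_apply, Pi.smul_apply, smul_eq_mul] at this
        simp only [B, c, Option.elim, Int.cast_natCast, mul_ite, mul_zero]
        rw [Finset.sum_ite_mem, Finset.univ_inter, ← this]
        exact Finset.sum_congr rfl fun k _ => mul_comm _ _
  obtain ⟨z, hz⟩ := hc.extremePoints_nonempty hne
  obtain ⟨h0, hint⟩ := exists_det_of_mem_extremePoints B c hz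
  generalize ((B.submatrix id (Subtype.val : {j // z j ≠ 0} → κ)).transpose *
        B.submatrix id (Subtype.val : {j // z j ≠ 0} → κ)).det = d at h0 hint
  have hnat : ∀ k, ∃ w : ℕ, (w : ℝ) = d.natAbs * z k := by
    intro k
    obtain ⟨t, ht⟩ := hint k
    refine ⟨t.natAbs, ?_⟩
    rw [Nat.cast_natAbs, Nat.cast_natAbs, Int.cast_abs, Int.cast_abs, ← ht, abs_mul,
      abs_of_nonneg (hz.1.1 k)]
  choose w hw using hnat
  have hsum : ((∑ k, w k : ℕ) : ℝ) = d.natAbs := by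
    rw [Nat.cast_sum, Finset.sum_congr rfl fun k _ => hw k, ← Finset.mul_sum, hone z hz.1, mul_one]
  refine ⟨w, ?_, fun i => ?_⟩
  · rw [Nat.cast_inj.1 hsum]
    exact Int.natAbs_pos.2 h0
  · have h1 := hz.1.2 (some i)
    simp only [B, c, Option.elim, Int.cast_natCast] at h1
    have h2 : ((∑ k, w k * v k i : ℕ) : ℝ) = ((∑ k, w k) * y i : ℕ) := by
      rw [Nat.cast_mul, hsum, Nat.cast_sum, ← h1, Finset.mul_sum]
      refine Finset.sum_congr rfl fun k _ => ?_
      rw [Nat.cast_mul, hw]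
      ring
    exact_mod_cast h2

end Vertices

/-! ### The semi-network linear coding capacity region as a projected packing polytope -/

theorem IsRationalPolytope.linear_image {ι ι' : Type*} {P : Set (ι → ℝ)}
    (hP : IsRationalPolytope P) (π : (ι → ℝ) →ₗ[ℝ] (ι' → ℝ)) (π' : (ι → ℚ) → ι' → ℚ)
    (h : ∀ q : ι → ℚ, π (fun i => (q i : ℝ)) = fun i => (π' q i : ℝ)) :
    IsRationalPolytope (π '' P) := by
  obtain ⟨s, hs, rfl⟩ := hP
  refine ⟨π' '' s, hs.image _, ?_⟩
  rw [π.image_convexHull, Set.image_image, Set.image_image]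
  congr 1
  exact Set.image_congr fun q _ => h q

theorem isRationalPolytope_packing {I E : Type*} [Fintype I] [Finite E] {a : I → E → Prop}
    [∀ i e, Decidable (a i e)] {cap : E → ℕ} (ha : ∀ i, ∃ e, a i e) :
    IsRationalPolytope (packing a cap) := by
  have := Fintype.ofFinite E
  let c : (I → ℚ) → I → ℝ := fun q i => (q i : ℝ)
  have hc : Function.Injective c := fun q q' h => funext fun i => Rat.cast_injective (congrFun h i)
  have hfin := finite_grid_points (isBounded_packing (cap := cap) ha)
    (commonDen (Fintype.card I + Fintype.card E)) (commonDen_pos _)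
  refine ⟨_, hfin.preimage (f := c) hc.injOn, ?_⟩
  have himg : c '' (c ⁻¹' {x ∈ packing a cap | ∃ w : I → ℕ, ∀ i,
      x i = w i / commonDen (Fintype.card I + Fintype.card E)}) =
      {x ∈ packing a cap | ∃ w : I → ℕ, ∀ i,
        x i = w i / commonDen (Fintype.card I + Fintype.card E)} := by
    rw [Set.image_preimage_eq_iff]
    rintro x ⟨-, w, hw⟩
    refine ⟨fun i => w i / commonDen (Fintype.card I + Fintype.card E), funext fun i => ?_⟩
    simp [c, hw]
  exact (packing_eq_convexHull ha le_rfl).trans (congrArg _ himg.symm)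

namespace CapNetwork

theorem simpleRates_subset_linearRates {V E M A F : Type*} [Field F] [Finite E]
    (N : CapNetwork V E M A) : N.simpleRates F ⊆ N.linearRates F := by
  rintro ρ ⟨k, n, C, hk, hn, ⟨hl, hs, -⟩, rfl⟩
  exact ⟨k, n, C, hk, hn, hl, hs, rfl⟩

variable {V E M A : Type*} {F : Type*} [Field F] [Finite V] [Finite E] [Finite M] [Finite F]
  {N : CapNetwork V E M A}

open Classical in
theorem packingPolytope_eq_packing :
    N.packingPolytope F = packing (fun (W : N.PartialSolution F) e => W.code.Uses e) N.cap :=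
  rfl

theorem isCompact_packingPolytope (hN : N.Nondegenerate) (hD : N.EveryMessageDemanded) :
    IsCompact (N.packingPolytope F) := by
  classical
  rw [packingPolytope_eq_packing]
  exact Metric.isCompact_of_isClosed_isBounded isClosed_packing
    (isBounded_packing fun W => W.exists_uses hN hD)

theorem tendsto_floor_add_div {y : ℝ} (s B : ℕ) (hy : 0 ≤ y) :
    Filter.Tendsto (fun n : ℕ => ((⌊y * n⌋₊ + s : ℕ) : ℝ) / ((n + B : ℕ) : ℝ)) Filter.atTop
      (nhds y) := by
  have h1 : Filter.Tendsto (fun n : ℕ => (⌊y * n⌋₊ : ℝ) / n) Filter.atTop (nhds y) :=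
    (tendsto_nat_floor_mul_div_atTop hy).comp tendsto_natCast_atTop_atTop
  have h2 : ∀ c : ℕ, Filter.Tendsto (fun n : ℕ => (c : ℝ) / n) Filter.atTop (nhds 0) := fun c =>
    tendsto_const_nhds.div_atTop tendsto_natCast_atTop_atTop
  have h3 := (h1.add (h2 s)).div ((tendsto_const_nhds (x := (1 : ℝ))).add (h2 B)) (by norm_num)
  rw [add_zero, add_zero, div_one] at h3
  refine h3.congr' ?_
  filter_upwards [Filter.eventually_gt_atTop 0] with n hn
  have hn' : (n : ℝ) ≠ 0 := Nat.cast_ne_zero.2 hn.ne'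
  simp only [Pi.div_apply, Nat.cast_add]
  have hnB : (n : ℝ) + B ≠ 0 := by positivity
  have hnB' : 1 + (B : ℝ) / n ≠ 0 := by positivity
  field_simp

/-- Every point of the projected packing polytope is a limit of rate vectors of simple solutions:
its weights are approximated from below by fractions, and one copy of a routing solution is added
for each message to make all rates positive. -/
theorem rateMap_image_subset (hN : N.Nondegenerate) (hA : Nat.card A ≤ Nat.card F) :
    N.rateMap F '' N.packingPolytope F ⊆ N.semiRegion F := by
  classical
  have := Fintype.ofFinite M
  rintro _ ⟨y, ⟨hy0, hy⟩, rfl⟩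
  choose S hS using exists_partialSolution_singleton (F := F) hN hA
  let s : N.PartialSolution F → ℕ := fun W => if W ∈ Finset.univ.image S then 1 else 0
  let B : ℕ := Fintype.card M
  have hs : ∑ W, s W ≤ B := by
    simp only [s]
    rw [Finset.sum_boole, Nat.cast_id, Finset.filter_mem_eq_inter, Finset.univ_inter]
    exact Finset.card_image_le
  let x : ℕ → N.PartialSolution F → ℕ := fun n W => ⌊y W * n⌋₊ + s W
  refine mem_closure_of_tendsto (f := fun n : ℕ => fun m =>
    ((∑ W, (if m ∈ W.T then x n W else 0) : ℕ) : ℝ) / ((n + B : ℕ) : ℝ)) (b := Filter.atTop) ?_ ?_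
  · rw [tendsto_pi_nhds]
    intro m
    have h1 : ∀ n : ℕ, ((∑ W, (if m ∈ W.T then x n W else 0) : ℕ) : ℝ) / ((n + B : ℕ) : ℝ) =
        ∑ W, (if m ∈ W.T then 1 else 0) * ((x n W : ℝ) / ((n + B : ℕ) : ℝ)) := by
      intro n
      rw [Nat.cast_sum, Finset.sum_div]
      refine Finset.sum_congr rfl fun W _ => ?_
      split_ifs <;> simp
    simp only [h1]
    exact tendsto_finsetSum _ fun W _ =>
      (tendsto_floor_add_div (s W) B (hy0 W)).const_mul (if m ∈ W.T then (1 : ℝ) else 0)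
  · filter_upwards [Filter.eventually_gt_atTop 0] with n hn
    refine mem_simpleRates_of_packing hA (x n) (Nat.add_pos_left hn B) (fun e => ?_) fun m => ?_
    · have h1 : ∑ W : N.PartialSolution F, (if W.code.Uses e then ⌊y W * n⌋₊ else 0) ≤
          n * N.cap e := by
        have h2 : ∑ W : N.PartialSolution F, (if W.code.Uses e then (⌊y W * n⌋₊ : ℝ) else 0) ≤
            (n : ℝ) * N.cap e := by
          refine le_trans ?_ (mul_le_mul_of_nonneg_left (hy e) (Nat.cast_nonneg n))
          rw [Finset.mul_sum]
          refine Finset.sum_le_sum fun W _ => ?_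
          split_ifs
          · rw [one_mul, mul_comm (n : ℝ)]
            exact Nat.floor_le (mul_nonneg (hy0 W) (Nat.cast_nonneg n))
          · simp
        exact_mod_cast h2
      have h3 : ∑ W, (if W.code.Uses e then s W else 0) ≤ B * N.cap e := by
        refine le_trans (Finset.sum_le_sum fun W _ => ?_)
          (hs.trans (Nat.le_mul_of_pos_right B (N.cap_pos e)))
        split_ifs
        · exact le_rfl
        · exact Nat.zero_le _
      calc ∑ W, (if W.code.Uses e then x n W else 0)
          = ∑ W : N.PartialSolution F, (if W.code.Uses e then ⌊y W * n⌋₊ else 0) +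
              ∑ W, (if W.code.Uses e then s W else 0) := by
            rw [← Finset.sum_add_distrib]
            refine Finset.sum_congr rfl fun W _ => ?_
            split_ifs <;> rfl
        _ ≤ n * N.cap e + B * N.cap e := add_le_add h1 h3
        _ = (n + B) * N.cap e := (add_mul _ _ _).symm
    · refine lt_of_lt_of_le ?_ (Finset.single_le_sum
        (f := fun W : N.PartialSolution F => if m ∈ W.T then x n W else 0)
        (fun _ _ => Nat.zero_le _) (Finset.mem_univ (S m)))
      have h1 : m ∈ (S m).T := by rw [hS]; rfl
      have h2 : s (S m) = 1 := if_pos (Finset.mem_image_of_mem _ (Finset.mem_univ m))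
      simp only [if_pos h1, x, h2]
      exact Nat.succ_pos _

theorem semiRegion_eq (hN : N.Nondegenerate) (hD : N.EveryMessageDemanded)
    (hA : Nat.card A ≤ Nat.card F) :
    N.semiRegion F = N.rateMap F '' N.packingPolytope F := by
  refine Set.Subset.antisymm (closure_minimal simpleRates_subset ?_) (rateMap_image_subset hN hA)
  exact ((isCompact_packingPolytope hN hD).image
    (LinearMap.continuous_on_pi (N.rateMap F))).isClosed

theorem isRationalPolytope_packingPolytope (hN : N.Nondegenerate) (hD : N.EveryMessageDemanded) :
    IsRationalPolytope (N.packingPolytope F) := by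
  classical
  rw [packingPolytope_eq_packing]
  exact isRationalPolytope_packing fun W => W.exists_uses hN hD

theorem isRationalPolytope_semiRegion (hN : N.Nondegenerate) (hD : N.EveryMessageDemanded)
    (hA : Nat.card A ≤ Nat.card F) : IsRationalPolytope (N.semiRegion F) := by
  classical
  rw [semiRegion_eq hN hD hA]
  refine (isRationalPolytope_packingPolytope hN hD).linear_image (N.rateMap F)
    (fun q m => ∑ W, (if m ∈ W.T then 1 else 0) * q W) fun q => funext fun m => ?_
  simp only [rateMap, LinearMap.coe_mk, AddHom.coe_mk, Rat.cast_sum, Rat.cast_mul]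
  exact Finset.sum_congr rfl fun W _ => by split_ifs <;> simp

theorem isBounded_semiRegion (hN : N.Nondegenerate) (hD : N.EveryMessageDemanded)
    (hA : Nat.card A ≤ Nat.card F) : Bornology.IsBounded (N.semiRegion F) := by
  rw [semiRegion_eq hN hD hA]
  have := Fintype.ofFinite M
  exact ((isCompact_packingPolytope hN hD).image
    (LinearMap.continuous_on_pi (N.rateMap F))).isBounded

end CapNetwork

/-! ### Certificates for the vertices of a lattice polytope -/

section Certificates

variable {ι κ : Type*} [Fintype ι] [Fintype κ]

/-- Certificate that the points `v k` are the vertices of the convex hull of the set `G` of points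
with integral coordinates: they belong to `G`, every point of `G` is a convex combination of them
with rational weights (the denominator being the sum of the integral weights), and each of them is
separated from the others by an integral linear form, written as a difference of two forms with
natural coefficients. -/
structure IsVertexCertificate (G : Set (ι → ℕ)) (v : κ → ι → ℕ) : Prop where
  mem : ∀ k, v k ∈ G
  combination : ∀ g ∈ G, ∃ w : κ → ℕ, 0 < ∑ k, w k ∧ ∀ i, ∑ k, w k * v k i = (∑ k, w k) * g i
  separation : ∀ k, ∃ a a' : ι → ℕ, ∀ k', v k' = v k ∨
    ∑ i, a i * v k' i + ∑ i, a' i * v k i < ∑ i, a i * v k i + ∑ i, a' i * v k' i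

namespace IsVertexCertificate

variable {G : Set (ι → ℕ)} {v : κ → ι → ℕ}

theorem convexHull_eq (h : IsVertexCertificate G v) :
    convexHull ℝ ((fun g i => (g i : ℝ)) '' G) =
      convexHull ℝ (Set.range fun k i => (v k i : ℝ)) := by
  refine Set.Subset.antisymm (convexHull_min ?_ (convex_convexHull ℝ _)) (convexHull_mono ?_)
  · rintro _ ⟨g, hg, rfl⟩
    obtain ⟨w, hpos, hw⟩ := h.combination g hg
    have hpos' : (0 : ℝ) < ∑ k, (w k : ℝ) := by exact_mod_cast hpos
    refine mem_convexHull_of_exists_fintype (fun k => (w k : ℝ) / ∑ k, (w k : ℝ))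
      (fun k i => (v k i : ℝ)) (fun k => by positivity) ?_ (fun k => ⟨k, rfl⟩) ?_
    · rw [← Finset.sum_div, div_self hpos'.ne']
    · funext i
      have h1 : (∑ k, (w k : ℝ) * v k i) = (∑ k, (w k : ℝ)) * g i := by exact_mod_cast hw i
      simp only [Finset.sum_apply, Pi.smul_apply, smul_eq_mul, div_mul_eq_mul_div]
      rw [← Finset.sum_div, h1, mul_comm, mul_div_assoc, div_self hpos'.ne', mul_one]
  · rintro _ ⟨k, rfl⟩
    exact ⟨v k, h.mem k, rfl⟩

theorem extremePoints_eq (h : IsVertexCertificate G v) :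
    Set.extremePoints ℝ (convexHull ℝ ((fun g i => (g i : ℝ)) '' G)) =
      Set.range fun k i => (v k i : ℝ) := by
  rw [h.convexHull_eq]
  refine Set.Subset.antisymm extremePoints_convexHull_subset ?_
  rintro _ ⟨k, rfl⟩
  set S : Set (ι → ℝ) := Set.range fun k i => (v k i : ℝ)
  have hSfin : S.Finite := Set.finite_range _
  have hmem : (fun i => (v k i : ℝ)) ∈ S := ⟨k, rfl⟩
  by_contra hne
  -- By the Krein–Milman theorem the point would be in the convex hull of the other ones.
  have hsub : convexHull ℝ S ⊆ convexHull ℝ (S \ {fun i => (v k i : ℝ)}) := by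
    nth_rewrite 1 [← closure_convexHull_extremePoints (hSfin.isCompact_convexHull ℝ)
      (convex_convexHull ℝ S)]
    refine closure_minimal (convexHull_mono fun x hx => ⟨extremePoints_convexHull_subset hx, ?_⟩)
      ((hSfin.subset Set.sdiff_subset).isClosed_convexHull ℝ)
    rintro rfl
    exact hne hx
  obtain ⟨a, a', haa⟩ := h.separation k
  let f : (ι → ℝ) →ₗ[ℝ] ℝ := ∑ i, ((a i : ℝ) - a' i) • LinearMap.proj i
  have hf : ∀ x, f x = ∑ i, ((a i : ℝ) - a' i) * x i := fun x => by simp [f]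
  have hlt : S \ {fun i => (v k i : ℝ)} ⊆ {x | f x < f fun i => (v k i : ℝ)} := by
    rintro _ ⟨⟨k', rfl⟩, hk'⟩
    obtain h1 | h1 := haa k'
    · exact absurd (congrArg (fun (g : ι → ℕ) i => (g i : ℝ)) h1) hk'
    · have h2 : (∑ i, (a i : ℝ) * v k' i) + ∑ i, (a' i : ℝ) * v k i <
          (∑ i, (a i : ℝ) * v k i) + ∑ i, (a' i : ℝ) * v k' i := by exact_mod_cast h1
      simp only [Set.mem_ofPred_eq, hf, sub_mul, Finset.sum_sub_distrib]
      linarith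
  have h3 := convexHull_min hlt (convex_halfSpace_lt f.isLinear _)
    (hsub (subset_convexHull ℝ S hmem))
  exact lt_irrefl (f fun i => (v k i : ℝ)) h3

end IsVertexCertificate

/-- A linear form strictly negative on finitely many vectors can be replaced by an integral one. -/
theorem exists_nat_form {α : ι → ℝ} (δ : κ → ι → ℝ) (h : ∀ k, ∑ i, α i * δ k i < 0) :
    ∃ a a' : ι → ℕ, ∀ k, ∑ i, ((a i : ℝ) - a' i) * δ k i < 0 := by
  have hlim : ∀ k, Filter.Tendsto (fun n : ℕ =>
      ∑ i, ((⌊max (α i) 0 * n⌋₊ : ℝ) / n - (⌊max (-α i) 0 * n⌋₊ : ℝ) / n) * δ k i) Filter.atTop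
      (nhds (∑ i, α i * δ k i)) := by
    intro k
    refine tendsto_finsetSum _ fun i _ => Filter.Tendsto.mul_const _ ?_
    have h1 : ∀ y : ℝ, 0 ≤ y → Filter.Tendsto (fun n : ℕ => (⌊y * n⌋₊ : ℝ) / n) Filter.atTop
        (nhds y) := fun y hy =>
      (tendsto_nat_floor_mul_div_atTop hy).comp tendsto_natCast_atTop_atTop
    have h2 := (h1 _ (le_max_right (α i) 0)).sub (h1 _ (le_max_right (-α i) 0))
    rwa [show max (α i) 0 - max (-α i) 0 = α i by
      rcases le_total (α i) 0 with h | h <;> simp [h]] at h2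
  have hev : ∀ᶠ n : ℕ in Filter.atTop, ∀ k,
      ∑ i, ((⌊max (α i) 0 * n⌋₊ : ℝ) / n - (⌊max (-α i) 0 * n⌋₊ : ℝ) / n) * δ k i < 0 :=
    Filter.eventually_all.2 fun k => (hlim k).eventually (eventually_lt_nhds (h k))
  obtain ⟨n, hn, hpos⟩ := (hev.and (Filter.eventually_gt_atTop 0)).exists
  refine ⟨fun i => ⌊max (α i) 0 * n⌋₊, fun i => ⌊max (-α i) 0 * n⌋₊, fun k => ?_⟩
  have h1 := hn k
  have hpos' : (0 : ℝ) < n := Nat.cast_pos.2 hpos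
  simp only [← sub_div, div_mul_eq_mul_div] at h1
  rw [← Finset.sum_div, div_lt_iff₀ hpos', zero_mul] at h1
  exact h1

/-- The vertices of a lattice polytope have a certificate. -/
theorem exists_isVertexCertificate {G : Set (ι → ℕ)} (hG : G.Finite) :
    ∃ (k : ℕ) (v : Fin k → ι → ℕ), IsVertexCertificate G v := by
  classical
  let c : (ι → ℕ) → ι → ℝ := fun g i => (g i : ℝ)
  have hc : Function.Injective c := fun g g' h => funext fun i => Nat.cast_injective (congrFun h i)
  set K := convexHull ℝ (c '' G)
  have hKc : IsCompact K := (hG.image c).isCompact_convexHull ℝ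
  let T : Set (ι → ℕ) := {g ∈ G | c g ∈ K.extremePoints ℝ}
  have hT : T.Finite := hG.subset fun g hg => hg.1
  have hext : K.extremePoints ℝ ⊆ c '' T := by
    intro x hx
    obtain ⟨g, hg, rfl⟩ := extremePoints_convexHull_subset hx
    exact ⟨g, ⟨hg, hx⟩, rfl⟩
  have hKT : K ⊆ convexHull ℝ (c '' T) := by
    rw [← closure_convexHull_extremePoints hKc (convex_convexHull ℝ _)]
    exact closure_minimal (convexHull_mono hext) ((hT.image c).isClosed_convexHull ℝ)
  have : Finite T := hT
  obtain ⟨k, ⟨φ⟩⟩ := Finite.exists_equiv_fin T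
  let v : Fin k → ι → ℕ := fun j => (φ.symm j).1
  have hrange : c '' T = Set.range fun j i => (v j i : ℝ) := by
    ext x
    constructor
    · rintro ⟨g, hg, rfl⟩
      exact ⟨φ ⟨g, hg⟩, by simp [v, c]⟩
    · rintro ⟨j, rfl⟩
      exact ⟨v j, (φ.symm j).2, rfl⟩
  refine ⟨k, v, fun j => (φ.symm j).2.1, fun g hg => ?_, fun j => ?_⟩
  · refine exists_nat_weights v g ?_
    rw [← hrange]
    exact hKT (subset_convexHull ℝ _ ⟨g, hg, rfl⟩)
  · have hx : c (v j) ∈ K.extremePoints ℝ := (φ.symm j).2.2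
    have hnot := ((convex_convexHull ℝ _).mem_extremePoints_iff_mem_sdiff_convexHull_sdiff.1 hx).2
    have hnot' : c (v j) ∉ convexHull ℝ (c '' (T \ {v j})) := by
      refine fun hmem => hnot (convexHull_mono ?_ hmem)
      rintro _ ⟨g, ⟨hg, hne⟩, rfl⟩
      exact ⟨subset_convexHull ℝ _ ⟨g, hg.1, rfl⟩, fun h => hne (hc h)⟩
    obtain ⟨f, u, hf1, hf2⟩ := geometric_hahn_banach_closed_point (convex_convexHull ℝ _)
      (((hT.subset Set.sdiff_subset).image c).isClosed_convexHull ℝ) hnot'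
    have hsum : ∀ x, f x = ∑ i, f (fun i' => if i = i' then 1 else 0) * x i := fun x => by
      refine (LinearMap.pi_apply_eq_sum_univ (f : (ι → ℝ) →ₗ[ℝ] ℝ) x).trans ?_
      exact Finset.sum_congr rfl fun i _ => mul_comm _ _
    obtain ⟨a, a', haa⟩ := exists_nat_form (κ := {j' // v j' ≠ v j})
      (α := fun i => f (fun i' => if i = i' then 1 else 0)) (fun j' i => c (v j') i - c (v j) i)
      (fun j' => by
        have h1 := hf1 (c (v j')) (subset_convexHull ℝ _ ⟨v j', ⟨(φ.symm j').2, j'.2⟩, rfl⟩)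
        simp only [mul_sub, Finset.sum_sub_distrib]
        rw [← hsum, ← hsum]
        linarith)
    refine ⟨a, a', fun j' => ?_⟩
    by_cases hj : v j' = v j
    · exact Or.inl hj
    · right
      have h1 := haa ⟨j', hj⟩
      simp only [c, sub_mul, mul_sub, Finset.sum_sub_distrib] at h1
      have h2 : (∑ i, (a i : ℝ) * v j' i) + ∑ i, (a' i : ℝ) * v j i <
          (∑ i, (a i : ℝ) * v j i) + ∑ i, (a' i : ℝ) * v j' i := by linarith
      exact_mod_cast h2

/-- A certificate for the vertices of a lattice polytope is one for its multiples. -/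
theorem IsVertexCertificate.scale {G : Set (ι → ℕ)} {v : κ → ι → ℕ}
    (h : IsVertexCertificate G v) {D : ℕ} (hD : 0 < D) :
    Set.extremePoints ℝ (convexHull ℝ ((fun g i => (g i : ℝ) / D) '' G)) =
      Set.range (fun k i => (v k i : ℝ) / D) ∧
    convexHull ℝ ((fun g i => (g i : ℝ) / D) '' G) =
      convexHull ℝ (Set.range fun k i => (v k i : ℝ) / D) := by
  have hD' : (D : ℝ)⁻¹ ≠ 0 := inv_ne_zero (Nat.cast_ne_zero.2 hD.ne')
  let φ : (ι → ℝ) ≃ₗ[ℝ] (ι → ℝ) := LinearEquiv.smulOfNeZero ℝ (ι → ℝ) (D : ℝ)⁻¹ hD'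
  have hφ : ∀ g : ι → ℕ, φ (fun i => (g i : ℝ)) = fun i => (g i : ℝ) / D := fun g => by
    funext i
    simp [φ, div_eq_inv_mul]
  have h1 : (fun (g : ι → ℕ) i => (g i : ℝ) / D) '' G = φ '' ((fun g i => (g i : ℝ)) '' G) := by
    rw [Set.image_image]
    exact Set.image_congr fun g _ => (hφ g).symm
  have h2 : Set.range (fun k i => (v k i : ℝ) / D) = φ '' Set.range fun k i => (v k i : ℝ) := by
    rw [← Set.range_comp]
    exact congrArg _ (funext fun k => (hφ (v k)).symm)
  have h3 : ∀ s : Set (ι → ℝ), convexHull ℝ (φ '' s) = φ '' convexHull ℝ s := fun s =>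
    (LinearMap.image_convexHull φ.toLinearMap s).symm
  rw [h1, h2, h3, h3, ← h.convexHull_eq, ← image_extremePoints φ, h.extremePoints_eq]
  exact ⟨rfl, rfl⟩

end Certificates

/-! ### Closure properties of primitive recursive functions and predicates -/

section Primrec

attribute [local fun_prop] Primrec
attribute [local fun_prop] Primrec.id Primrec.const Primrec.comp Primrec.pair

variable {α β γ : Type*} [Primcodable α] [Primcodable β] [Primcodable γ]

theorem Primrec.fst_comp {f : α → β × γ} (hf : Primrec f) : Primrec fun a => (f a).1 :=
  Primrec.fst.comp hf

theorem Primrec.snd_comp {f : α → β × γ} (hf : Primrec f) : Primrec fun a => (f a).2 :=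
  Primrec.snd.comp hf

theorem Primrec.nat_add_comp {f g : α → ℕ} (hf : Primrec f) (hg : Primrec g) :
    Primrec fun a => f a + g a :=
  Primrec.nat_add.comp hf hg

theorem Primrec.nat_mul_comp {f g : α → ℕ} (hf : Primrec f) (hg : Primrec g) :
    Primrec fun a => f a * g a :=
  Primrec.nat_mul.comp hf hg

theorem Primrec.nat_pow_comp {f g : α → ℕ} (hf : Primrec f) (hg : Primrec g) :
    Primrec fun a => f a ^ g a := by
  refine (Primrec.nat_rec' (h := fun a q => q.2 * f a) hg (Primrec.const 1) ?_).of_eq fun a => ?_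
  · exact Primrec.nat_mul.comp (Primrec.snd.comp Primrec.snd) (hf.comp Primrec.fst)
  · induction g a with
    | zero => rfl
    | succ n ih => rw [pow_succ, ← ih]

theorem Primrec.factorial_comp {f : α → ℕ} (hf : Primrec f) :
    Primrec fun a => (f a).factorial := by
  refine (Primrec.nat_rec' (h := fun _ q => (q.1 + 1) * q.2) hf (Primrec.const 1) ?_).of_eq
    fun a => ?_
  · exact Primrec.nat_mul.comp (Primrec.succ.comp (Primrec.fst.comp Primrec.snd))
      (Primrec.snd.comp Primrec.snd)
  · induction f a with
    | zero => rfl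
    | succ n ih => rw [Nat.factorial_succ, ← ih]

theorem Primrec.getD_comp {f : α → List β} {g : α → ℕ} (b : β) (hf : Primrec f)
    (hg : Primrec g) : Primrec fun a => (f a).getD (g a) b :=
  (Primrec.list_getD b).comp hf hg

theorem Primrec.length_comp {f : α → List β} (hf : Primrec f) :
    Primrec fun a => (f a).length :=
  Primrec.list_length.comp hf

theorem Primrec.sum_range {f : α → ℕ} {g : α → ℕ → β} [AddCommMonoid β]
    (hadd : Primrec₂ fun x y : β => x + y) (hf : Primrec f)
    (hg : Primrec fun x : α × ℕ => g x.1 x.2) :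
    Primrec fun a => ∑ i ∈ Finset.range (f a), g a i := by
  refine (Primrec.nat_rec' (h := fun a q => q.2 + g a q.1) hf (Primrec.const 0) ?_).of_eq
    fun a => ?_
  · exact hadd.comp (Primrec.snd.comp Primrec.snd)
      (hg.comp (Primrec.fst.pair (Primrec.fst.comp Primrec.snd)))
  · induction f a with
    | zero => rfl
    | succ n ih => rw [Finset.sum_range_succ, ← ih]

theorem PrimrecPred.exists_lt' {f : α → ℕ} {p : α → ℕ → Prop} (hf : Primrec f)
    (hp : PrimrecPred fun x : α × ℕ => p x.1 x.2) : PrimrecPred fun a => ∃ i < f a, p a i := by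
  have h : PrimrecRel fun (i : ℕ) (a : α) => p a i :=
    hp.comp (Primrec.snd.pair Primrec.fst)
  exact ((PrimrecRel.exists_mem_list h).comp (Primrec.list_range.comp hf) Primrec.id).of_eq
    fun a => by simp

theorem PrimrecPred.forall_lt' {f : α → ℕ} {p : α → ℕ → Prop} (hf : Primrec f)
    (hp : PrimrecPred fun x : α × ℕ => p x.1 x.2) : PrimrecPred fun a => ∀ i < f a, p a i := by
  have h : PrimrecRel fun (i : ℕ) (a : α) => p a i :=
    hp.comp (Primrec.snd.pair Primrec.fst)
  exact ((PrimrecRel.forall_mem_list h).comp (Primrec.list_range.comp hf) Primrec.id).of_eq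
    fun a => by simp

theorem PrimrecPred.imp {p q : α → Prop} (hp : PrimrecPred p) (hq : PrimrecPred q) :
    PrimrecPred fun a => p a → q a :=
  (hp.not.or hq).of_eq fun _ => imp_iff_not_or.symm

theorem PrimrecPred.iff {p q : α → Prop} (hp : PrimrecPred p) (hq : PrimrecPred q) :
    PrimrecPred fun a => p a ↔ q a :=
  ((hp.imp hq).and (hq.imp hp)).of_eq fun _ => iff_def.symm

theorem PrimrecPred.eq_comp {f g : α → β} (hf : Primrec f) (hg : Primrec g) :
    PrimrecPred fun a => f a = g a :=
  Primrec.eq.comp hf hg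

theorem PrimrecPred.lt_comp {f g : α → ℕ} (hf : Primrec f) (hg : Primrec g) :
    PrimrecPred fun a => f a < g a :=
  Primrec.nat_lt.comp hf hg

theorem PrimrecPred.le_comp {f g : α → ℕ} (hf : Primrec f) (hg : Primrec g) :
    PrimrecPred fun a => f a ≤ g a :=
  Primrec.nat_le.comp hf hg

theorem Primrec.commonDen_comp {f : α → ℕ} (hf : Primrec f) :
    Primrec fun a => commonDen (f a) :=
  Primrec.factorial_comp (Primrec.nat_mul_comp (Primrec.factorial_comp hf)
    (Primrec.nat_pow_comp (Primrec.nat_add_comp hf (Primrec.const 1)) hf))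

/-- The digit with index `i` of the number `c` in base `b`. A number below `b ^ n` is used as a code
for a function from the numbers below `n` to the numbers below `b`. -/
def digit (b c i : ℕ) : ℕ := c / b ^ i % b

theorem Primrec.digit_comp {b c i : α → ℕ} (hb : Primrec b) (hc : Primrec c) (hi : Primrec i) :
    Primrec fun a => digit (b a) (c a) (i a) :=
  Primrec.nat_mod.comp (Primrec.nat_div.comp hc (Primrec.nat_pow_comp hb hi)) hb

end Primrec

/-- Every function with values below `b` is coded by a number. -/
theorem exists_digits {b n : ℕ} (h : Fin n → ℕ) (hb : ∀ i, h i < b) :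
    ∃ c < b ^ n, ∀ i : Fin n, digit b c i = h i := by
  let φ : Fin n → Fin b := fun i => ⟨h i, hb i⟩
  refine ⟨finFunctionFinEquiv φ, (finFunctionFinEquiv φ).2, fun i => ?_⟩
  have h1 := congrFun (finFunctionFinEquiv.symm_apply_apply φ) i
  exact congrArg Fin.val h1

/-! ### Primitive recursive description of partial scalar-linear solutions -/

namespace CapNetwork

section Numeric

attribute [local fun_prop] Primrec
attribute [local fun_prop] Primrec.id Primrec.const Primrec.comp Primrec.pair Primrec.fst_comp
  Primrec.snd_comp Primrec.nat_add_comp Primrec.nat_mul_comp Primrec.nat_pow_comp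
  Primrec.length_comp Primrec.commonDen_comp Primrec.digit_comp

namespace Description

/-- number of messages -/
def numMsg (d : Description) : ℕ := d.2.1

/-- number of edges -/
def numEdge (d : Description) : ℕ := d.2.2.2.1.length

/-- start node of an edge; like the other entries below, it has an arbitrary value out of range -/
def src (d : Description) (i : ℕ) : ℕ := (d.2.2.2.1.getD i (0, 0, 0)).1

/-- end node of an edge -/
def tgt (d : Description) (i : ℕ) : ℕ := (d.2.2.2.1.getD i (0, 0, 0)).2.1

/-- capacity of an edge -/
def cap (d : Description) (i : ℕ) : ℕ := (d.2.2.2.1.getD i (0, 0, 0)).2.2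

/-- the table of the source mapping -/
def gen (d : Description) (x j : ℕ) : Bool := (d.2.2.2.2.1.getD x []).getD j false

/-- the table of the receiver mapping -/
def dem (d : Description) (x j : ℕ) : Bool := (d.2.2.2.2.2.getD x []).getD j false

section

variable {α : Type*} [Primcodable α] {d : α → Description} {i j x : α → ℕ}

theorem primrec_numMsg (hd : Primrec d) : Primrec fun a => (d a).numMsg := by
  unfold numMsg; fun_prop

theorem primrec_numEdge (hd : Primrec d) : Primrec fun a => (d a).numEdge := by
  unfold numEdge; fun_prop

theorem primrec_src (hd : Primrec d) (hi : Primrec i) : Primrec fun a => (d a).src (i a) :=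
  Primrec.fst_comp (Primrec.getD_comp _ (by fun_prop) hi)

theorem primrec_tgt (hd : Primrec d) (hi : Primrec i) : Primrec fun a => (d a).tgt (i a) :=
  Primrec.fst_comp (Primrec.snd_comp (Primrec.getD_comp _ (by fun_prop) hi))

theorem primrec_cap (hd : Primrec d) (hi : Primrec i) : Primrec fun a => (d a).cap (i a) :=
  Primrec.snd_comp (Primrec.snd_comp (Primrec.getD_comp _ (by fun_prop) hi))

theorem primrec_gen (hd : Primrec d) (hx : Primrec x) (hj : Primrec j) :
    Primrec fun a => (d a).gen (x a) (j a) :=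
  Primrec.getD_comp _ (Primrec.getD_comp _ (by fun_prop) hx) hj

theorem primrec_dem (hd : Primrec d) (hx : Primrec x) (hj : Primrec j) :
    Primrec fun a => (d a).dem (x a) (j a) :=
  Primrec.getD_comp _ (Primrec.getD_comp _ (by fun_prop) hx) hj

end

attribute [local fun_prop] primrec_numMsg primrec_numEdge primrec_src primrec_tgt primrec_cap
  primrec_gen primrec_dem

variable {F : Type*} [Field F] (enum : ℕ → F) (s : ℕ)

/-- The entry at the message `j` of the global coding vector of the edge `i`, where the family of
all global coding vectors is coded by `g`. -/
def codingEntry (d : Description) (g i j : ℕ) : F :=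
  enum (digit s (digit (s ^ d.numMsg) g i) j)

theorem primrec_codingEntry {F α : Type*} [Primcodable F] [Primcodable α] {enum : ℕ → F} {s : ℕ}
    {d : α → Description} {g i j : α → ℕ} (henum : Primrec enum) (hd : Primrec d) (hg : Primrec g)
    (hi : Primrec i) (hj : Primrec j) :
    Primrec fun a => codingEntry enum s (d a) (g a) (i a) (j a) :=
  henum.comp (by fun_prop)

/-- The entry at the message `j` of the combination, with coefficients coded by `γ` and `δ`, of what
is available at the node `x`. -/
def nodeEntry (d : Description) (g x γ δ j : ℕ) : F :=
  (if d.gen x j = true then enum (digit s γ j) else 0) +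
    ∑ i ∈ Finset.range d.numEdge,
      if d.tgt i = x then enum (digit s δ i) * codingEntry enum s d g i j else 0

/-- The coding vector of the edge `i` is a combination of what is available at its start node. -/
def EdgeCondition (d : Description) (p g i : ℕ) : Prop :=
  ∃ γ < s ^ d.numMsg, ∃ δ < s ^ d.numEdge, ∀ j < d.numMsg, digit 2 p j = 1 →
    codingEntry enum s d g i j = nodeEntry enum s d g (d.src i) γ δ j

/-- The unit vector of the message `j` is a combination of what is available at the node `x`. -/
def DemandCondition (d : Description) (p g x j : ℕ) : Prop :=
  ∃ γ < s ^ d.numMsg, ∃ δ < s ^ d.numEdge, ∀ j' < d.numMsg, digit 2 p j' = 1 →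
    nodeEntry enum s d g x γ δ j' = if j' = j then 1 else 0

/-- The binary digits of `p` are the indicator of the message set, followed by the indicator of the
set of active edges, of a partial scalar-linear solution. -/
def IsPattern (d : Description) (p : ℕ) : Prop :=
  (∃ j < d.numMsg, digit 2 p j = 1) ∧ ∃ g < (s ^ d.numMsg) ^ d.numEdge,
    (∀ i < d.numEdge, EdgeCondition enum s d p g i) ∧
    (∀ x < d.1, ∀ j < d.numMsg, d.dem x j = true → digit 2 p j = 1 →
      DemandCondition enum s d p g x j) ∧
    ∀ i < d.numEdge, digit 2 p (d.numMsg + i) = 1 ↔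
      ∃ j < d.numMsg, digit 2 p j = 1 ∧ codingEntry enum s d g i j ≠ 0

section

variable {α : Type*} [Primcodable α] [Primcodable F] [Finite F] {enum} {s}
  {d : α → Description} {p g x i j γ δ : α → ℕ}

theorem primrec_nodeEntry (henum : Primrec enum) (hd : Primrec d) (hg : Primrec g)
    (hx : Primrec x) (hγ : Primrec γ) (hδ : Primrec δ) (hj : Primrec j) :
    Primrec fun a => nodeEntry enum s (d a) (g a) (x a) (γ a) (δ a) (j a) := by
  have hadd : Primrec₂ fun y z : F => y + z := Primrec.dom_finite _
  have hmul : Primrec₂ fun y z : F => y * z := Primrec.dom_finite _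
  refine hadd.comp ?_ (Primrec.sum_range hadd (by fun_prop) ?_)
  · exact Primrec.ite (PrimrecPred.eq_comp (by fun_prop) (by fun_prop))
      (henum.comp (by fun_prop)) (Primrec.const 0)
  · exact Primrec.ite (PrimrecPred.eq_comp (by fun_prop) (by fun_prop))
      (hmul.comp (henum.comp (by fun_prop))
        (primrec_codingEntry henum (by fun_prop) (by fun_prop) (by fun_prop) (by fun_prop)))
      (Primrec.const 0)

theorem primrecPred_edgeCondition (henum : Primrec enum) (hd : Primrec d) (hp : Primrec p)
    (hg : Primrec g) (hi : Primrec i) :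
    PrimrecPred fun a => EdgeCondition enum s (d a) (p a) (g a) (i a) := by
  refine PrimrecPred.exists_lt' (by fun_prop) <| PrimrecPred.exists_lt' (by fun_prop) <|
    PrimrecPred.forall_lt' (by fun_prop) <|
    (PrimrecPred.eq_comp (by fun_prop) (by fun_prop)).imp <| PrimrecPred.eq_comp ?_ ?_
  · exact primrec_codingEntry henum (by fun_prop) (by fun_prop) (by fun_prop) (by fun_prop)
  · exact primrec_nodeEntry henum (by fun_prop) (by fun_prop) (by fun_prop) (by fun_prop)
      (by fun_prop) (by fun_prop)

theorem primrecPred_demandCondition (henum : Primrec enum) (hd : Primrec d) (hp : Primrec p)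
    (hg : Primrec g) (hx : Primrec x) (hj : Primrec j) :
    PrimrecPred fun a => DemandCondition enum s (d a) (p a) (g a) (x a) (j a) := by
  refine PrimrecPred.exists_lt' (by fun_prop) <| PrimrecPred.exists_lt' (by fun_prop) <|
    PrimrecPred.forall_lt' (by fun_prop) <|
    (PrimrecPred.eq_comp (by fun_prop) (by fun_prop)).imp <| PrimrecPred.eq_comp ?_ ?_
  · exact primrec_nodeEntry henum (by fun_prop) (by fun_prop) (by fun_prop) (by fun_prop)
      (by fun_prop) (by fun_prop)
  · exact Primrec.ite (PrimrecPred.eq_comp (by fun_prop) (by fun_prop)) (Primrec.const 1)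
      (Primrec.const 0)

theorem primrecPred_isPattern (henum : Primrec enum) (hd : Primrec d) (hp : Primrec p) :
    PrimrecPred fun a => IsPattern enum s (d a) (p a) := by
  refine PrimrecPred.and ?_ <| PrimrecPred.exists_lt' (by fun_prop) <|
    PrimrecPred.and ?_ <| PrimrecPred.and ?_ ?_
  · exact PrimrecPred.exists_lt' (by fun_prop) (PrimrecPred.eq_comp (by fun_prop) (by fun_prop))
  · exact PrimrecPred.forall_lt' (by fun_prop) <|
      primrecPred_edgeCondition henum (by fun_prop) (by fun_prop) (by fun_prop) (by fun_prop)
  · refine PrimrecPred.forall_lt' (by fun_prop) <| PrimrecPred.forall_lt' (by fun_prop) <|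
      (PrimrecPred.eq_comp (by fun_prop) (by fun_prop)).imp <|
      (PrimrecPred.eq_comp (by fun_prop) (by fun_prop)).imp ?_
    exact primrecPred_demandCondition henum (by fun_prop) (by fun_prop) (by fun_prop)
      (by fun_prop) (by fun_prop)
  · refine PrimrecPred.forall_lt' (by fun_prop) <|
      (PrimrecPred.eq_comp (by fun_prop) (by fun_prop)).iff <|
      PrimrecPred.exists_lt' (by fun_prop) <|
      (PrimrecPred.eq_comp (by fun_prop) (by fun_prop)).and <| PrimrecPred.not <|
      PrimrecPred.eq_comp ?_ (Primrec.const 0)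
    exact primrec_codingEntry henum (by fun_prop) (by fun_prop) (by fun_prop) (by fun_prop)

end

end Description

end Numeric

end CapNetwork

/-! ### A search for the vertices -/

namespace CapNetwork

section Search

attribute [local fun_prop] Primrec
attribute [local fun_prop] Primrec.id Primrec.const Primrec.comp Primrec.pair Primrec.fst_comp
  Primrec.snd_comp Primrec.nat_add_comp Primrec.nat_mul_comp Primrec.nat_pow_comp
  Primrec.length_comp Primrec.commonDen_comp Primrec.digit_comp

namespace Description

attribute [local fun_prop] primrec_numMsg primrec_numEdge primrec_src primrec_tgt primrec_cap
  primrec_gen primrec_dem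

/-- The number of pairs of a set of messages and a set of edges. -/
def numPattern (d : Description) : ℕ := 2 ^ (d.numMsg + d.numEdge)

/-- A common denominator of the vertices of the packing polytope over the patterns. -/
def den (d : Description) : ℕ := commonDen (d.numPattern + d.numEdge)

/-- A strict bound for the numerators of the vertices of the packing polytope over the patterns. -/
def base (d : Description) : ℕ := d.den * ∑ i ∈ Finset.range d.numEdge, d.cap i + 1

/-- The rate of the message `j` under the packing with multiplicities coded by `z`. -/
def rate (d : Description) (z j : ℕ) : ℕ :=
  ∑ p ∈ Finset.range d.numPattern, if digit 2 p j = 1 then digit d.base z p else 0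

variable {F : Type*} [Field F] (enum : ℕ → F) (s : ℕ)

/-- The digits of `z`, divided by the common denominator, are the weights of a packing of
patterns of partial scalar-linear solutions. -/
def Feasible (d : Description) (z : ℕ) : Prop :=
  (∀ p < d.numPattern, digit d.base z p ≠ 0 → IsPattern enum s d p) ∧
  ∀ i < d.numEdge, ∑ p ∈ Finset.range d.numPattern,
    (if digit 2 p (d.numMsg + i) = 1 then digit d.base z p else 0) ≤ d.den * d.cap i

/-- The rates, multiplied by the common denominator, of the packings on the grid. -/
def gridRates (d : Description) : Set (Fin d.numMsg → ℕ) :=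
  {g | ∃ z < d.base ^ d.numPattern, Feasible enum s d z ∧ ∀ j : Fin d.numMsg, g j = d.rate z j}

/-- The numerator of the coordinate `j` of the entry `k` of a list of points. -/
def num (l : List (List (ℕ × ℕ))) (k j : ℕ) : ℕ := ((l.getD k []).getD j (0, 1)).1

/-- The list `l` of points, all with the common denominator, satisfies the conditions of a vertex
certificate for the grid rates, where all coefficients are below `B`. -/
def Certified (d : Description) (l : List (List (ℕ × ℕ))) (B : ℕ) : Prop :=
  (∀ k < l.length, (l.getD k []).length = d.numMsg ∧
    ∀ j < d.numMsg, ((l.getD k []).getD j (0, 1)).2 = d.den) ∧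
  (∀ k < l.length, ∃ z < d.base ^ d.numPattern, Feasible enum s d z ∧
    ∀ j < d.numMsg, num l k j = d.rate z j) ∧
  (∀ z < d.base ^ d.numPattern, Feasible enum s d z → ∃ w < B ^ l.length,
    0 < ∑ k ∈ Finset.range l.length, digit B w k ∧
    ∀ j < d.numMsg, ∑ k ∈ Finset.range l.length, digit B w k * num l k j =
      (∑ k ∈ Finset.range l.length, digit B w k) * d.rate z j) ∧
  ∀ k < l.length, ∃ a < B ^ d.numMsg, ∃ a' < B ^ d.numMsg, ∀ k' < l.length,
    (∀ j < d.numMsg, num l k' j = num l k j) ∨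
    ∑ j ∈ Finset.range d.numMsg, digit B a j * num l k' j +
        ∑ j ∈ Finset.range d.numMsg, digit B a' j * num l k j <
      ∑ j ∈ Finset.range d.numMsg, digit B a j * num l k j +
        ∑ j ∈ Finset.range d.numMsg, digit B a' j * num l k' j

section

variable {α : Type*} [Primcodable α] {d : α → Description} {z j k : α → ℕ}
  {l : α → List (List (ℕ × ℕ))} {B : α → ℕ}

theorem primrec_numPattern (hd : Primrec d) : Primrec fun a => (d a).numPattern := by
  unfold numPattern; fun_prop

attribute [local fun_prop] primrec_numPattern

theorem primrec_den (hd : Primrec d) : Primrec fun a => (d a).den := by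
  unfold den; fun_prop

attribute [local fun_prop] primrec_den

theorem primrec_base (hd : Primrec d) : Primrec fun a => (d a).base :=
  Primrec.nat_add_comp (Primrec.nat_mul_comp (by fun_prop)
    (Primrec.sum_range Primrec.nat_add (by fun_prop) (by fun_prop))) (Primrec.const 1)

attribute [local fun_prop] primrec_base

theorem primrec_rate (hd : Primrec d) (hz : Primrec z) (hj : Primrec j) :
    Primrec fun a => (d a).rate (z a) (j a) :=
  Primrec.sum_range Primrec.nat_add (by fun_prop)
    (Primrec.ite (PrimrecPred.eq_comp (by fun_prop) (by fun_prop)) (by fun_prop) (Primrec.const 0))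

attribute [local fun_prop] primrec_rate

theorem primrec_num (hl : Primrec l) (hk : Primrec k) (hj : Primrec j) :
    Primrec fun a => num (l a) (k a) (j a) :=
  Primrec.fst_comp (Primrec.getD_comp _ (Primrec.getD_comp _ hl hk) hj)

attribute [local fun_prop] primrec_num

variable [Primcodable F] [Finite F] {enum} {s}

theorem primrecPred_feasible (henum : Primrec enum) (hd : Primrec d) (hz : Primrec z) :
    PrimrecPred fun a => Feasible enum s (d a) (z a) := by
  refine PrimrecPred.and ?_ ?_
  · refine PrimrecPred.forall_lt' (by fun_prop) <| PrimrecPred.imp (PrimrecPred.not ?_) ?_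
    · exact PrimrecPred.eq_comp (by fun_prop) (Primrec.const 0)
    · exact primrecPred_isPattern henum (by fun_prop) (by fun_prop)
  · refine PrimrecPred.forall_lt' (by fun_prop) <| PrimrecPred.le_comp ?_ (by fun_prop)
    exact Primrec.sum_range Primrec.nat_add (by fun_prop)
      (Primrec.ite (PrimrecPred.eq_comp (by fun_prop) (by fun_prop)) (by fun_prop)
        (Primrec.const 0))

theorem primrecPred_certified (henum : Primrec enum) (hd : Primrec d) (hl : Primrec l)
    (hB : Primrec B) : PrimrecPred fun a => Certified enum s (d a) (l a) (B a) := by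
  refine PrimrecPred.and ?_ <| PrimrecPred.and ?_ <| PrimrecPred.and ?_ ?_
  · refine PrimrecPred.forall_lt' (by fun_prop) <| PrimrecPred.and ?_ ?_
    · exact PrimrecPred.eq_comp
        (Primrec.length_comp (Primrec.getD_comp _ (by fun_prop) (by fun_prop))) (by fun_prop)
    · exact PrimrecPred.forall_lt' (by fun_prop) <| PrimrecPred.eq_comp
        (Primrec.snd_comp (Primrec.getD_comp _ (Primrec.getD_comp _ (by fun_prop) (by fun_prop))
          (by fun_prop))) (by fun_prop)
  · refine PrimrecPred.forall_lt' (by fun_prop) <| PrimrecPred.exists_lt' (by fun_prop) <|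
      (primrecPred_feasible henum (by fun_prop) (by fun_prop)).and <|
      PrimrecPred.forall_lt' (by fun_prop) <| PrimrecPred.eq_comp (by fun_prop) (by fun_prop)
  · have hsum : ∀ {β : Type _} [Primcodable β] {l : β → List (List (ℕ × ℕ))} {B w : β → ℕ},
        Primrec l → Primrec B → Primrec w →
        Primrec fun a => ∑ k ∈ Finset.range (l a).length, digit (B a) (w a) k :=
      fun hl hB hw => Primrec.sum_range Primrec.nat_add (by fun_prop) (by fun_prop)
    refine PrimrecPred.forall_lt' (by fun_prop) <|
      (primrecPred_feasible henum (by fun_prop) (by fun_prop)).imp <|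
      PrimrecPred.exists_lt' (by fun_prop) <| PrimrecPred.and ?_ <|
      PrimrecPred.forall_lt' (by fun_prop) <| PrimrecPred.eq_comp ?_ ?_
    · exact PrimrecPred.lt_comp (Primrec.const 0) (hsum (by fun_prop) (by fun_prop) (by fun_prop))
    · exact Primrec.sum_range Primrec.nat_add (by fun_prop) (by fun_prop)
    · exact Primrec.nat_mul_comp (hsum (by fun_prop) (by fun_prop) (by fun_prop)) (by fun_prop)
  · refine PrimrecPred.forall_lt' (by fun_prop) <| PrimrecPred.exists_lt' (by fun_prop) <|
      PrimrecPred.exists_lt' (by fun_prop) <| PrimrecPred.forall_lt' (by fun_prop) <|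
      PrimrecPred.or (PrimrecPred.forall_lt' (by fun_prop) <|
        PrimrecPred.eq_comp (by fun_prop) (by fun_prop)) <|
      PrimrecPred.lt_comp (Primrec.nat_add_comp ?_ ?_) (Primrec.nat_add_comp ?_ ?_)
    all_goals exact Primrec.sum_range Primrec.nat_add (by fun_prop) (by fun_prop)

end

end Description

end Search

end CapNetwork

namespace CapNetwork

namespace Description

variable {F : Type*} [Field F] (enum : ℕ → F) (s : ℕ)

theorem Certified.isVertexCertificate {enum : ℕ → F} {s : ℕ} {d : Description}
    {l : List (List (ℕ × ℕ))} {B : ℕ} (h : Certified enum s d l B) :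
    IsVertexCertificate (gridRates enum s d)
      fun (k : Fin l.length) (j : Fin d.numMsg) => num l k j := by
  obtain ⟨-, h1, h2, h3⟩ := h
  refine ⟨fun k => ?_, ?_, fun k => ?_⟩
  · obtain ⟨z, hz, hf, hr⟩ := h1 k k.2
    exact ⟨z, hz, hf, fun j => hr j j.2⟩
  · rintro g ⟨z, hz, hf, hr⟩
    obtain ⟨w, -, hpos, hw⟩ := h2 z hz hf
    simp only [Finset.sum_range] at hpos hw
    exact ⟨fun k => digit B w k, hpos, fun j => by rw [hr j]; exact hw j j.2⟩
  · obtain ⟨a, -, a', -, haa⟩ := h3 k k.2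
    simp only [Finset.sum_range] at haa
    refine ⟨fun j => digit B a j, fun j => digit B a' j, fun k' => ?_⟩
    obtain h4 | h4 := haa k' k'.2
    · exact Or.inl (funext fun j => h4 j j.2)
    · exact Or.inr h4

theorem finite_gridRates (d : Description) : (gridRates enum s d).Finite := by
  refine ((Set.finite_lt_nat (d.base ^ d.numPattern)).image
    fun z (j : Fin d.numMsg) => d.rate z j).subset ?_
  rintro g ⟨z, hz, -, hr⟩
  exact ⟨z, hz, (funext hr).symm⟩

theorem exists_digits_eventually {n : ℕ} (h : Fin n → ℕ) :
    ∀ᶠ B in Filter.atTop, ∃ c < B ^ n, ∀ i : Fin n, digit B c i = h i := by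
  filter_upwards [Filter.eventually_all.2 fun i => Filter.eventually_gt_atTop (h i)] with B hB
  exact exists_digits h hB

/-- For every description the search succeeds. -/
theorem exists_certified (d : Description) : ∃ l B, Certified enum s d l B := by
  obtain ⟨n, v, hv⟩ := exists_isVertexCertificate (finite_gridRates enum s d)
  let l : List (List (ℕ × ℕ)) := List.ofFn fun k => List.ofFn fun j => (v k j, d.den)
  have hlen : l.length = n := List.length_ofFn
  have hget : ∀ k : Fin n, l.getD k [] = List.ofFn fun j => (v k j, d.den) := fun k => by
    simp [l, List.getD_eq_getElem?_getD]
  have hget' : ∀ (k : Fin n) (j : Fin d.numMsg),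
      (l.getD k []).getD j (0, 1) = (v k j, d.den) := fun k j => by
    rw [hget]
    simp [List.getD_eq_getElem?_getD]
  have hnum : ∀ (k : Fin n) (j : Fin d.numMsg), num l k j = v k j := fun k j =>
    congrArg Prod.fst (hget' k j)
  have h1 : ∀ᶠ B in Filter.atTop, ∀ z ∈ Finset.range (d.base ^ d.numPattern), Feasible enum s d z →
      ∃ w < B ^ n, 0 < ∑ k ∈ Finset.range n, digit B w k ∧
      ∀ j < d.numMsg, ∑ k ∈ Finset.range n, digit B w k * num l k j =
        (∑ k ∈ Finset.range n, digit B w k) * d.rate z j := by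
    rw [Filter.eventually_all_finset]
    intro z hz
    by_cases hf : Feasible enum s d z
    · obtain ⟨w, hpos, hw⟩ := hv.combination (fun j => d.rate z j)
        ⟨z, Finset.mem_range.1 hz, hf, fun _ => rfl⟩
      filter_upwards [exists_digits_eventually w] with B hB _
      obtain ⟨c, hc, hcw⟩ := hB
      refine ⟨c, hc, ?_⟩
      simp only [Finset.sum_range, hcw]
      refine ⟨hpos, fun j hj => ?_⟩
      rw [← hw ⟨j, hj⟩]
      exact Finset.sum_congr rfl fun k _ => by rw [← hnum k ⟨j, hj⟩]
    · exact Filter.Eventually.of_forall fun _ h => absurd h hf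
  have h2 : ∀ᶠ B in Filter.atTop, ∀ k : Fin n, ∃ a < B ^ d.numMsg, ∃ a' < B ^ d.numMsg,
      ∀ k' < n, (∀ j < d.numMsg, num l k' j = num l k j) ∨
      ∑ j ∈ Finset.range d.numMsg, digit B a j * num l k' j +
          ∑ j ∈ Finset.range d.numMsg, digit B a' j * num l k j <
        ∑ j ∈ Finset.range d.numMsg, digit B a j * num l k j +
          ∑ j ∈ Finset.range d.numMsg, digit B a' j * num l k' j := by
    rw [Filter.eventually_all]
    intro k
    obtain ⟨a, a', haa⟩ := hv.separation k
    filter_upwards [exists_digits_eventually a, exists_digits_eventually a'] with B hB hB'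
    obtain ⟨c, hc, hca⟩ := hB
    obtain ⟨c', hc', hca'⟩ := hB'
    refine ⟨c, hc, c', hc', fun k' hk' => ?_⟩
    simp only [Finset.sum_range, hca, hca', hnum k]
    have hn' : ∀ j : Fin d.numMsg, num l k' j = v ⟨k', hk'⟩ j := hnum ⟨k', hk'⟩
    simp only [hn']
    obtain h3 | h3 := haa ⟨k', hk'⟩
    · refine Or.inl fun j hj => ?_
      rw [hn' ⟨j, hj⟩, h3]
      exact (hnum k ⟨j, hj⟩).symm
    · exact Or.inr h3
  obtain ⟨B, hB1, hB2⟩ := (h1.and h2).exists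
  refine ⟨l, B, ?_⟩
  unfold Certified
  rw [hlen]
  refine ⟨fun k hk => ⟨?_, fun j hj => ?_⟩, fun k hk => ?_,
    fun z hz hf => hB1 z (Finset.mem_range.2 hz) hf, fun k hk => hB2 ⟨k, hk⟩⟩
  · rw [hget ⟨k, hk⟩, List.length_ofFn]
  · rw [hget' ⟨k, hk⟩ ⟨j, hj⟩]
  · obtain ⟨z, hz, hf, hr⟩ := hv.mem ⟨k, hk⟩
    exact ⟨z, hz, hf, fun j hj => (hnum ⟨k, hk⟩ ⟨j, hj⟩).trans (hr ⟨j, hj⟩)⟩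

/-- A computable function finds a certified list of points for every description. -/
theorem exists_computable_certified [Primcodable F] [Finite F] {enum : ℕ → F}
    (henum : Primrec enum) (s : ℕ) :
    ∃ f : Description → List (List (ℕ × ℕ)), Computable f ∧
      ∀ d, ∃ B, Certified enum s d (f d) B := by
  classical
  let c : ℕ → List (List (ℕ × ℕ)) × ℕ := fun n => (Encodable.decode n).getD ([], 0)
  have hc : Primrec c := Primrec.option_getD.comp Primrec.decode (Primrec.const ([], 0))
  have hP : PrimrecPred fun q : Description × ℕ => Certified enum s q.1 (c q.2).1 (c q.2).2 :=
    primrecPred_certified henum Primrec.fst (Primrec.fst_comp (hc.comp Primrec.snd))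
      (Primrec.snd_comp (hc.comp Primrec.snd))
  have hex : ∀ d : Description, ∃ n, Certified enum s d (c n).1 (c n).2 := by
    intro d
    obtain ⟨l, B, h⟩ := exists_certified enum s d
    exact ⟨Encodable.encode (l, B), by simpa [c] using h⟩
  refine ⟨fun d => (c (Nat.find (hex d))).1, ?_, fun d => ⟨_, Nat.find_spec (hex d)⟩⟩
  exact (Primrec.fst_comp hc).to_comp.comp (Computable.find
    (P := fun d n => Certified enum s d (c n).1 (c n).2) hP.computablePred hex)

end Description

end CapNetwork

/-! ### Descriptions of networks -/

namespace CapNetwork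

section Bridge

variable {v e m q : ℕ} (N : CapNetwork (Fin v) (Fin e) (Fin m) (Fin q))

theorem numEdge_description : N.description.numEdge = e := List.length_ofFn

theorem src_description (i : Fin e) : N.description.src i = N.src i := by
  simp [Description.src, description, List.getD_eq_getElem?_getD]

theorem tgt_description (i : Fin e) : N.description.tgt i = N.tgt i := by
  simp [Description.tgt, description, List.getD_eq_getElem?_getD]

theorem cap_description (i : Fin e) : N.description.cap i = N.cap i := by
  simp [Description.cap, description, List.getD_eq_getElem?_getD]

theorem gen_description (x : Fin v) (j : Fin m) :
    N.description.gen x j = true ↔ j ∈ N.S x := by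
  simp [Description.gen, description, List.getD_eq_getElem?_getD]

theorem dem_description (x : Fin v) (j : Fin m) :
    N.description.dem x j = true ↔ j ∈ N.R x := by
  simp [Description.dem, description, List.getD_eq_getElem?_getD]

theorem exists_code {F : Type*} {enum : ℕ → F} {s n : ℕ} (henum : ∀ y, ∃ i < s, enum i = y)
    (γ : Fin n → F) :
    ∃ c < s ^ n, ∀ j : Fin n, enum (digit s c j) = γ j := by
  choose h hs hh using henum
  obtain ⟨c, hc, hcd⟩ := exists_digits (fun j => h (γ j)) fun j => hs _
  exact ⟨c, hc, fun j => by rw [hcd, hh]⟩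

theorem exists_code₂ {F : Type*} {enum : ℕ → F} {s n n' : ℕ} (henum : ∀ y, ∃ i < s, enum i = y)
    (g : Fin n' → Fin n → F) :
    ∃ c < (s ^ n) ^ n', ∀ (i : Fin n') (j : Fin n),
      enum (digit s (digit (s ^ n) c i) j) = g i j := by
  choose h hs hh using fun i => exists_code henum (g i)
  obtain ⟨c, hc, hcd⟩ := exists_digits h hs
  exact ⟨c, hc, fun i j => by rw [hcd, hh]⟩

variable {F : Type*} [Field F] {enum : ℕ → F} {s : ℕ}

theorem nodeEntry_description (g : ℕ) (x : Fin v) (γ δ : ℕ) (j : Fin m) :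
    Description.nodeEntry enum s N.description g x γ δ j =
      N.nodeComb (fun (i : Fin e) (j : Fin m) => Description.codingEntry enum s N.description g i j)
        x (fun j => enum (digit s γ j)) (fun i => enum (digit s δ i)) j := by
  classical
  unfold Description.nodeEntry nodeComb
  rw [numEdge_description, Finset.sum_range]
  simp only [gen_description, tgt_description, Fin.val_inj]

/-- For the description of a network, the numerical patterns are those of the partial
scalar-linear solutions. -/
theorem isPattern_description_iff (hA : Nat.card (Fin q) ≤ Nat.card F)
    (henum : ∀ y, ∃ i < s, enum i = y) (p : ℕ) :
    Description.IsPattern enum s N.description p ↔ ∃ W : N.PartialSolution F,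
      (∀ j : Fin m, j ∈ W.T ↔ digit 2 p j = 1) ∧
      ∀ i : Fin e, W.code.Uses i ↔ digit 2 p (m + i) = 1 := by
  constructor
  · rintro ⟨⟨j, hj, hjp⟩, g, -, hE, hR, hU⟩
    rw [numEdge_description] at hE hU
    let T : Set (Fin m) := {j | digit 2 p j = 1}
    have hcod : N.IsCoding T fun (i : Fin e) (j : Fin m) =>
        Description.codingEntry enum s N.description g i j := by
      refine ⟨fun i => ?_, fun x j hj hjT => ?_⟩
      · obtain ⟨γ, -, δ, -, h⟩ := hE i i.2
        refine ⟨fun j => enum (digit s γ j), fun i => enum (digit s δ i), fun j hj => ?_⟩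
        rw [h j j.2 hj, src_description, nodeEntry_description]
      · obtain ⟨γ, -, δ, -, h⟩ := hR x x.2 j j.2 ((N.dem_description x j).2 hj) hjT
        refine ⟨fun j => enum (digit s γ j), fun i => enum (digit s δ i), fun j' hj' => ?_⟩
        rw [← nodeEntry_description, h j' j'.2 hj']
        simp only [Fin.val_inj]
    obtain ⟨W, hWT, hWU⟩ := hcod.exists_partialSolution ⟨⟨j, hj⟩, hjp⟩ hA
    refine ⟨W, fun j => by rw [hWT]; rfl, fun i => ?_⟩
    rw [hWU]
    refine Iff.trans ?_ (hU i i.2).symm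
    exact ⟨fun ⟨j, h1, h2⟩ => ⟨j, j.2, h1, h2⟩, fun ⟨j, h0, h1, h2⟩ => ⟨⟨j, h0⟩, h1, h2⟩⟩
  · rintro ⟨W, hT, hU⟩
    obtain ⟨g, hcod, hWU⟩ := W.exists_isCoding
    obtain ⟨c, hc, hcg⟩ := exists_code₂ henum g
    have hentry : (fun (i : Fin e) (j : Fin m) =>
        Description.codingEntry enum s N.description c i j) = g := funext₂ hcg
    have hentry' : ∀ (i : Fin e) (j : Fin m),
        Description.codingEntry enum s N.description c i j = g i j := hcg
    obtain ⟨j₀, hj₀⟩ := W.nonempty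
    refine ⟨⟨j₀, j₀.2, (hT j₀).1 hj₀⟩, c, ?_, ?_, ?_, ?_⟩
    · rw [numEdge_description]
      exact hc
    · intro i hi
      rw [numEdge_description] at hi
      obtain ⟨γ, δ, h⟩ := hcod.edge ⟨i, hi⟩
      obtain ⟨γ', hγ, hγ'⟩ := exists_code henum γ
      obtain ⟨δ', hδ, hδ'⟩ := exists_code henum δ
      refine ⟨γ', hγ, δ', by rw [numEdge_description]; exact hδ, fun j hj hjp => ?_⟩
      have h1 := h ⟨j, hj⟩ ((hT _).2 hjp)
      rw [← funext hγ', ← funext hδ', ← hentry, ← nodeEntry_description, ← src_description] at h1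
      exact h1
    · intro x hx j hj hdem hjp
      obtain ⟨γ, δ, h⟩ := hcod.demand ⟨x, hx⟩ ⟨j, hj⟩
        ((N.dem_description ⟨x, hx⟩ ⟨j, hj⟩).1 hdem) ((hT _).2 hjp)
      obtain ⟨γ', hγ, hγ'⟩ := exists_code henum γ
      obtain ⟨δ', hδ, hδ'⟩ := exists_code henum δ
      refine ⟨γ', hγ, δ', by rw [numEdge_description]; exact hδ, fun j' hj' hjp' => ?_⟩
      have h1 := h ⟨j', hj'⟩ ((hT _).2 hjp')
      rw [← funext hγ', ← funext hδ', ← hentry, ← nodeEntry_description] at h1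
      exact h1.trans (if_congr Fin.ext_iff rfl rfl)
    · intro i hi
      rw [numEdge_description] at hi
      refine (hU ⟨i, hi⟩).symm.trans ((hWU ⟨i, hi⟩).trans ?_)
      constructor
      · rintro ⟨j, h1, h2⟩
        exact ⟨j, j.2, (hT j).1 h1, by rw [hentry' ⟨i, hi⟩ j]; exact h2⟩
      · rintro ⟨j, hj, h1, h2⟩
        exact ⟨⟨j, hj⟩, (hT ⟨j, hj⟩).2 h1, by rw [← hentry' ⟨i, hi⟩ ⟨j, hj⟩]; exact h2⟩

end Bridge

end CapNetwork

/-! ### The region as the convex hull of the grid rates -/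

/-- A packing is carried over along a map of index sets that preserves the incidences. -/
theorem exists_packing_of_map {I J E : Type*} [Fintype I] [Fintype J] [DecidableEq J]
    {a : I → E → Prop} {b : J → E → Prop} [∀ i e, Decidable (a i e)] [∀ j e, Decidable (b j e)]
    {cap : E → ℕ} (φ : I → J) (hφ : ∀ i e, b (φ i) e ↔ a i e) {x : I → ℝ}
    (hx : x ∈ packing a cap) :
    ∃ y ∈ packing b cap, ∀ c : J → ℝ, ∑ j, c j * y j = ∑ i, c (φ i) * x i := by
  have key : ∀ c : J → ℝ,
      ∑ j, c j * (∑ i, if φ i = j then x i else 0) = ∑ i, c (φ i) * x i := by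
    intro c
    simp only [Finset.mul_sum, mul_ite, mul_zero]
    rw [Finset.sum_comm]
    exact Finset.sum_congr rfl fun i _ => by simp
  refine ⟨fun j => ∑ i, if φ i = j then x i else 0, ⟨fun j => ?_, fun e => ?_⟩, key⟩
  · exact Finset.sum_nonneg fun i _ => by split_ifs <;> simp [hx.1 i]
  · rw [key fun j => if b j e then 1 else 0]
    simp only [hφ]
    exact hx.2 e

namespace CapNetwork

section Region

variable {v e m q : ℕ} {N : CapNetwork (Fin v) (Fin e) (Fin m) (Fin q)} {F : Type*} [Field F]
  {enum : ℕ → F} {s : ℕ}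

open Description in
/-- Sums over all patterns are sums over the valid ones, for packings supported on these. -/
theorem sum_pattern {d : Description} [Fintype {p : Fin d.numPattern // IsPattern enum s d p}]
    {z : ℕ} (hz : ∀ p < d.numPattern, digit d.base z p ≠ 0 → IsPattern enum s d p)
    (c : ℕ → Prop) [DecidablePred c] :
    ∑ p ∈ Finset.range d.numPattern, (if c p then digit d.base z p else 0) =
      ∑ i : {p : Fin d.numPattern // IsPattern enum s d p},
        if c i.1 then digit d.base z i.1 else 0 := by
  classical
  rw [Finset.sum_range, sum_subtype_eq_sum_ite (fun p : Fin d.numPattern => IsPattern enum s d p)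
    (fun p : Fin d.numPattern => if c p then digit d.base z p else 0)]
  refine Finset.sum_congr rfl fun p _ => ?_
  by_cases h : IsPattern enum s d p
  · rw [if_pos h]
  · have h0 : digit d.base z p = 0 := by
      by_contra hne
      exact h (hz p p.2 hne)
    simp [h, h0]

open Description in
/-- The region is the convex hull of the rates of the packings on the grid. Partial solutions with
the same pattern are interchangeable in packings, so patterns can serve as index set. -/
theorem semiRegion_eq_convexHull_gridRates [Finite F] (hN : N.Nondegenerate)
    (hD : N.EveryMessageDemanded) (hA : Nat.card (Fin q) ≤ Nat.card F)
    (henum : ∀ y, ∃ i < s, enum i = y) :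
    N.semiRegion F = convexHull ℝ ((fun (g : Fin m → ℕ) j => (g j : ℝ) / N.description.den) ''
      gridRates enum s N.description) := by
  classical
  set d := N.description
  have hE : d.numEdge = e := N.numEdge_description
  let I := {p : Fin d.numPattern // IsPattern enum s d p}
  let a : I → Fin e → Prop := fun p i => digit 2 p.1 (m + i) = 1
  have hW : ∀ p : I, ∃ W : N.PartialSolution F, (∀ j : Fin m, j ∈ W.T ↔ digit 2 p.1 j = 1) ∧
      ∀ i : Fin e, W.code.Uses i ↔ digit 2 p.1 (m + i) = 1 := fun p =>
    (N.isPattern_description_iff hA henum p.1).1 p.2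
  choose ψ hψT hψU using hW
  have hP : ∀ W : N.PartialSolution F, ∃ p : I, (∀ j : Fin m, digit 2 p.1 j = 1 ↔ j ∈ W.T) ∧
      ∀ i : Fin e, digit 2 p.1 (m + i) = 1 ↔ W.code.Uses i := by
    intro W
    obtain ⟨p, hp, hpd⟩ := exists_digits (b := 2) (n := m + e)
      (Fin.addCases (fun j => if j ∈ W.T then 1 else 0) fun i => if W.code.Uses i then 1 else 0)
      (fun i => by
        refine Fin.addCases (fun j => ?_) (fun j => ?_) i
        · rw [Fin.addCases_left]
          split_ifs <;> norm_num
        · rw [Fin.addCases_right]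
          split_ifs <;> norm_num)
    have h1 : ∀ j : Fin m, digit 2 p j = 1 ↔ j ∈ W.T := by
      intro j
      have := hpd (Fin.castAdd e j)
      rw [Fin.addCases_left, Fin.val_castAdd] at this
      rw [this]
      split_ifs with h <;> simp [h]
    have h2 : ∀ i : Fin e, digit 2 p (m + i) = 1 ↔ W.code.Uses i := by
      intro i
      have := hpd (Fin.natAdd m i)
      rw [Fin.addCases_right, Fin.val_natAdd] at this
      rw [this]
      split_ifs with h <;> simp [h]
    have hp' : p < d.numPattern := by
      rw [numPattern, hE]
      exact hp
    exact ⟨⟨⟨p, hp'⟩, (N.isPattern_description_iff hA henum p).2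
      ⟨W, fun j => (h1 j).symm, fun i => (h2 i).symm⟩⟩, h1, h2⟩
  choose φ hφT hφU using hP
  let ρ : (I → ℝ) →ₗ[ℝ] (Fin m → ℝ) := LinearMap.pi fun j =>
    ∑ i : I, (if digit 2 i.1 j = 1 then (1 : ℝ) else 0) • LinearMap.proj i
  have hρ : ∀ x j, ρ x j = ∑ i : I, (if digit 2 i.1 j = 1 then 1 else 0) * x i := fun x j => by
    simp only [ρ, LinearMap.pi_apply, LinearMap.sum_apply, LinearMap.smul_apply,
      LinearMap.proj_apply, smul_eq_mul]
  -- The pattern of a partial solution determines its role in the packing polytope.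
  have himg : N.rateMap F '' N.packingPolytope F = ρ '' packing a N.cap := by
    rw [packingPolytope_eq_packing]
    refine Set.Subset.antisymm ?_ ?_
    · rintro _ ⟨x, hx, rfl⟩
      obtain ⟨y, hy, hyc⟩ := exists_packing_of_map (b := a) φ (fun W i => hφU W i) hx
      refine ⟨y, hy, funext fun j => ?_⟩
      rw [hρ, hyc fun i => if digit 2 i.1 j = 1 then 1 else 0]
      simp only [hφT]
      rfl
    · rintro _ ⟨x, hx, rfl⟩
      obtain ⟨y, hy, hyc⟩ := exists_packing_of_map
        (b := fun (W : N.PartialSolution F) i => W.code.Uses i) ψ (fun p i => hψU p i) hx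
      refine ⟨y, hy, funext fun j => ?_⟩
      rw [hρ]
      refine (hyc fun W => if j ∈ W.T then 1 else 0).trans ?_
      simp only [hψT]
  have huse : ∀ p : I, ∃ i, a p i := fun p => by
    obtain ⟨i, hi⟩ := (ψ p).exists_uses hN hD
    exact ⟨i, (hψU p i).1 hi⟩
  have hcard : Fintype.card I + Fintype.card (Fin e) ≤ d.numPattern + d.numEdge := by
    rw [Fintype.card_fin, hE]
    exact Nat.add_le_add_right ((Fintype.card_subtype_le _).trans (Fintype.card_fin _).le) _
  have hDpos : (0 : ℝ) < d.den := Nat.cast_pos.2 (commonDen_pos _)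
  rw [semiRegion_eq hN hD hA, himg, packing_eq_convexHull huse hcard, ρ.image_convexHull]
  congr 1
  -- Both sides are the rates of the packings on the grid, the multiplicities being coded by a
  -- number on the right-hand side.
  have hcapR : ∀ (w : I → ℕ) (i : Fin e),
      ∑ p : I, (if a p i then 1 else 0) * ((w p : ℝ) / d.den) ≤ N.cap i ↔
        ∑ p : I, (if a p i then w p else 0) ≤ d.den * N.cap i := by
    intro w i
    have h1 : ∑ p : I, (if a p i then 1 else 0) * ((w p : ℝ) / d.den) =
        ((∑ p : I, (if a p i then w p else 0) : ℕ) : ℝ) / d.den := by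
      rw [Nat.cast_sum, Finset.sum_div]
      exact Finset.sum_congr rfl fun p _ => by split_ifs <;> simp
    rw [h1, div_le_iff₀ hDpos, mul_comm]
    exact_mod_cast Iff.rfl
  have hrate : ∀ (w : I → ℕ) (j : Fin m), ρ (fun p => (w p : ℝ) / d.den) j =
      ((∑ p : I, (if digit 2 p.1 j = 1 then w p else 0) : ℕ) : ℝ) / d.den := by
    intro w j
    rw [hρ, Nat.cast_sum, Finset.sum_div]
    exact Finset.sum_congr rfl fun p _ => by split_ifs <;> simp
  refine Set.Subset.antisymm ?_ ?_
  · rintro _ ⟨x, ⟨hx, w, hw⟩, rfl⟩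
    have hw' : ∀ p, x p = w p / d.den := hw
    obtain rfl : x = fun p => (w p : ℝ) / d.den := funext hw'
    have hbase : ∀ p, w p < d.base := by
      intro p
      obtain ⟨i, hi⟩ := huse p
      have h1 := (hcapR w i).1 (hx.2 i)
      have h2 : w p ≤ d.den * N.cap i := by
        refine le_trans ?_ h1
        refine le_of_eq_of_le ?_ (Finset.single_le_sum
          (f := fun p : I => if a p i then w p else 0) (fun _ _ => Nat.zero_le _)
          (Finset.mem_univ p))
        simp [hi]
      have h3 : N.cap i ≤ ∑ i ∈ Finset.range d.numEdge, d.cap i := by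
        rw [← N.cap_description i]
        exact Finset.single_le_sum (f := d.cap) (fun _ _ => Nat.zero_le _)
          (Finset.mem_range.2 (by rw [hE]; exact i.2))
      exact Nat.lt_succ_of_le (h2.trans (Nat.mul_le_mul_left _ h3))
    obtain ⟨z, hz, hzd⟩ := exists_digits (b := d.base) (n := d.numPattern)
      (fun p => if h : IsPattern enum s d p then w ⟨p, h⟩ else 0) (fun p => by
        by_cases h : IsPattern enum s d p
        · rw [dif_pos h]
          exact hbase _
        · rw [dif_neg h]
          exact Nat.succ_pos _)
    have hzw : ∀ p : I, digit d.base z p.1 = w p := fun p => by rw [hzd, dif_pos p.2]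
    have hz0 : ∀ p < d.numPattern, digit d.base z p ≠ 0 → IsPattern enum s d p := by
      intro p hp hne
      by_contra h
      exact hne ((hzd ⟨p, hp⟩).trans (dif_neg h))
    refine ⟨fun j => d.rate z j, ⟨z, hz, ⟨hz0, fun i hi => ?_⟩, fun j => rfl⟩,
      funext fun j => ?_⟩
    · rw [hE] at hi
      rw [sum_pattern hz0 fun p => digit 2 p (d.numMsg + i) = 1]
      simp only [hzw]
      have h1 := (hcapR w ⟨i, hi⟩).1 (hx.2 ⟨i, hi⟩)
      rwa [← N.cap_description ⟨i, hi⟩] at h1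
    · rw [hrate]
      simp only [rate]
      rw [sum_pattern hz0 fun p => digit 2 p j = 1]
      simp only [hzw]
      rfl
  · rintro _ ⟨g, ⟨z, hz, hf, hg⟩, rfl⟩
    have hg' : ∀ j : Fin m, g j = d.rate z j := hg
    refine ⟨fun p => ((digit d.base z p.1 : ℕ) : ℝ) / d.den, ⟨⟨fun p => by positivity,
      fun i => (hcapR _ i).2 ?_⟩, fun p => digit d.base z p.1, fun p => rfl⟩, funext fun j => ?_⟩
    · have h1 := hf.2 i (by rw [hE]; exact i.2)
      rw [sum_pattern hf.1 fun p => digit 2 p (d.numMsg + i) = 1, N.cap_description] at h1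
      exact h1
    · rw [hrate fun p => digit d.base z p.1]
      simp only [hg', rate]
      rw [sum_pattern hf.1 fun p => digit 2 p j = 1]

open Description in
theorem Description.Certified.isVertexDescription [Finite F] (hN : N.Nondegenerate)
    (hD : N.EveryMessageDemanded) (hA : Nat.card (Fin q) ≤ Nat.card F)
    (henum : ∀ y, ∃ i < s, enum i = y) {l : List (List (ℕ × ℕ))} {B : ℕ}
    (h : Certified enum s N.description l B) : IsVertexDescription l (N.semiRegion F) := by
  have hden : 0 < N.description.den := commonDen_pos _
  obtain ⟨h1, h2⟩ := h.isVertexCertificate.scale hden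
  have hpt : {y : Fin m → ℝ | ∃ p ∈ l, y = pointOfFractions m p} =
      Set.range fun (k : Fin l.length) (j : Fin m) => (num l k j : ℝ) / N.description.den := by
    have hk : ∀ k : Fin l.length, pointOfFractions m (l.getD k []) =
        fun j : Fin m => (num l k j : ℝ) / N.description.den := fun k => by
      funext j
      simp only [pointOfFractions]
      rw [(h.1 k k.2).2 j j.2]
      rfl
    ext y
    constructor
    · rintro ⟨p, hp, rfl⟩
      obtain ⟨k, hk', rfl⟩ := List.getElem_of_mem hp
      refine ⟨⟨k, hk'⟩, (hk ⟨k, hk'⟩).symm.trans ?_⟩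
      rw [List.getD_eq_getElem _ _ hk']
    · rintro ⟨k, rfl⟩
      refine ⟨l.getD k [], ?_, (hk k).symm⟩
      rw [List.getD_eq_getElem _ _ k.2]
      exact List.getElem_mem k.2
  refine ⟨fun p hp => ?_, ?_, ?_⟩
  · obtain ⟨k, hk, rfl⟩ := List.getElem_of_mem hp
    have h3 := h.1 k hk
    rw [List.getD_eq_getElem _ _ hk] at h3
    refine ⟨h3.1, fun c hc => ?_⟩
    obtain ⟨j, hj, rfl⟩ := List.getElem_of_mem hc
    have h4 := h3.2 j (h3.1 ▸ hj)
    rw [List.getD_eq_getElem _ _ hj] at h4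
    rw [h4]
    exact hden
  · rw [hpt, semiRegion_eq_convexHull_gridRates hN hD hA henum]
    exact h1
  · rw [hpt, semiRegion_eq_convexHull_gridRates hN hD hA henum]
    exact h2

end Region

/-- The elements of a finite field can be enumerated by a primitive recursive function. -/
theorem exists_primrec_enum (F : Type*) [Field F] [Finite F] :
    ∃ (_ : Primcodable F) (enum : ℕ → F) (s : ℕ), Primrec enum ∧ ∀ y, ∃ i < s, enum i = y := by
  have hpos : 0 < Nat.card F := Nat.card_pos
  let φ : F ≃ Fin (Nat.card F) := Finite.equivFin F
  let inst : Primcodable F := Primcodable.ofEquiv _ φ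
  have hmod : Primrec fun n : ℕ => (⟨n % Nat.card F, Nat.mod_lt n hpos⟩ : Fin (Nat.card F)) :=
    Primrec.fin_val_iff.1 (Primrec.nat_mod.comp Primrec.id (Primrec.const _))
  refine ⟨inst, fun n => φ.symm ⟨n % Nat.card F, Nat.mod_lt n hpos⟩, Nat.card F,
    (Primrec.dom_finite φ.symm).comp hmod, fun y => ⟨φ y, (φ y).2, ?_⟩⟩
  simp [Nat.mod_eq_of_lt (φ y).2]

end CapNetwork

theorem mainTheorem6 (F : Type) [Field F] [Finite F] :
    (∀ (V E M A : Type*) [Finite V] [Finite E] [Finite M] (N : CapNetwork V E M A),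
      N.Nondegenerate → N.EveryMessageDemanded → Nat.card A ≤ Nat.card F →
        IsRationalPolytope (N.semiRegion F) ∧
        Bornology.IsBounded (N.semiRegion F) ∧
        (∀ ρ ∈ N.semiRegion F, ∀ m, 0 ≤ ρ m) ∧
        IsRationalPolytope (N.packingPolytope F) ∧
        N.semiRegion F = N.rateMap F '' N.packingPolytope F ∧
        N.semiRegion F ⊆ N.linearRegionOver F ∧
        N.semiRegion F ⊆ N.linearRegion) ∧
    ∃ f : CapNetwork.Description → List (List (ℕ × ℕ)), Computable f ∧
      ∀ (v e m q : ℕ) (N : CapNetwork (Fin v) (Fin e) (Fin m) (Fin q)),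
        N.Nondegenerate → N.EveryMessageDemanded → Nat.card (Fin q) ≤ Nat.card F →
          IsVertexDescription (f N.description) (N.semiRegion F) := by
  refine ⟨fun V E M A _ _ _ N hN hD hA => ⟨CapNetwork.isRationalPolytope_semiRegion hN hD hA,
    CapNetwork.isBounded_semiRegion hN hD hA, ?_,
    CapNetwork.isRationalPolytope_packingPolytope hN hD, CapNetwork.semiRegion_eq hN hD hA,
    closure_mono N.simpleRates_subset_linearRates,
    closure_mono fun ρ hρ => ⟨F, _, ‹_›, N.simpleRates_subset_linearRates hρ⟩⟩, ?_⟩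
  · rw [CapNetwork.semiRegion_eq hN hD hA]
    rintro _ ⟨x, hx, rfl⟩ m
    exact Finset.sum_nonneg fun W _ => mul_nonneg (by split_ifs <;> norm_num) (hx.1 W)
  · obtain ⟨_, enum, s, hprim, henum⟩ := CapNetwork.exists_primrec_enum F
    obtain ⟨f, hf, hcert⟩ := CapNetwork.Description.exists_computable_certified hprim s
    refine ⟨f, hf, fun v e m q N hN hD hA => ?_⟩
    obtain ⟨B, hB⟩ := hcert N.description
    exact hB.isVertexDescription hN hD hA henum
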